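/- Let $G$ be a finite simple graph with at least three vertices that is isomorphic to the cube $P_3(T)$ of some tree $T$. Here $P_3(T)$ is the graph on the vertex set of $T$ in which two distinct vertices are adjacent if and only if their distance in $T$ is at most $3$. The deck of a finite graph is the multiset of the isomorphism classes of its vertex-deleted subgraphs, one for each vertex. Then $G$ is determined up to isomorphism by its deck: every finite simple graph $H$ (not assumed to be the cube of a tree) that has the same deck as $G$ is isomorphic to $G$. -/

import Mathlib

namespace TreeCube

universe u

/-- The relation "isomorphic" on finite simple graphs with vertex set `{0, …, n - 1}`. -/
def isoSetoid : Setoid (Σ n : ℕ, SimpleGraph (Fin n)) where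
  r A B := Nonempty (A.2 ≃g B.2)
  iseqv :=
    { refl := fun _ => ⟨SimpleGraph.Iso.refl⟩
      symm := fun ⟨f⟩ => ⟨f.symm⟩
      trans := fun ⟨f⟩ ⟨g⟩ => ⟨g.comp f⟩ }

/-- Finite unlabelled graphs: isomorphism classes of finite simple graphs. -/
def UnlabelledGraph : Type := Quotient isoSetoid

/-- The unlabelled graph (isomorphism class) of a finite simple graph. -/
noncomputable def unlabelled {V : Type u} [Finite V] (G : SimpleGraph V) : UnlabelledGraph :=
  Quotient.mk isoSetoid ⟨Nat.card V, G.map (Finite.equivFin V).toEmbedding⟩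

/-- Two finite graphs give the same unlabelled graph exactly when they are isomorphic. -/
theorem unlabelled_eq_iff {V W : Type*} [Finite V] [Finite W]
    (G : SimpleGraph V) (H : SimpleGraph W) :
    unlabelled G = unlabelled H ↔ Nonempty (G ≃g H) := by
  have eG := SimpleGraph.Iso.map (Finite.equivFin V) G
  have eH := SimpleGraph.Iso.map (Finite.equivFin W) H
  constructor
  · intro h
    obtain ⟨f⟩ : Nonempty (G.map (Finite.equivFin V).toEmbedding ≃g
        H.map (Finite.equivFin W).toEmbedding) := Quotient.exact h
    exact ⟨(eH.symm.comp f).comp eG⟩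
  · rintro ⟨f⟩
    exact Quotient.sound (s := isoSetoid) ⟨(eH.comp f).comp eG.symm⟩

/-- The card of `G` at `v`, as a labelled graph: `G` with the vertex `v` and all edges at `v`
removed. -/
def deleteVertex {V : Type u} (G : SimpleGraph V) (v : V) : SimpleGraph {w : V // w ≠ v} :=
  G.comap Subtype.val

/-- The deck of a finite graph: the multiset of its unlabelled vertex-deleted subgraphs, one for
each vertex. -/
noncomputable def deck {V : Type u} [Fintype V] (G : SimpleGraph V) : Multiset UnlabelledGraph :=
  (Finset.univ : Finset V).val.map fun v => unlabelled (deleteVertex G v)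

/-- The `k`-th power of a graph: two distinct vertices are adjacent if and only if their distance
is at most `k` (the distance being infinite between different components). -/
def power {V : Type u} (G : SimpleGraph V) (k : ℕ) : SimpleGraph V where
  Adj x y := x ≠ y ∧ G.edist x y ≤ k
  symm := ⟨fun _ _ h => ⟨h.1.symm, by rw [SimpleGraph.edist_comm]; exact h.2⟩⟩
  loopless := ⟨fun _ h => h.1 rfl⟩

/-- `G` is isomorphic to the cube (third power) of some tree. -/
def IsCubeOfTree {V : Type u} (G : SimpleGraph V) : Prop :=
  ∃ (U : Type u) (T : SimpleGraph U), T.IsTree ∧ Nonempty (G ≃g power T 3)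

end TreeCube

/-! Call a vertex simplicial if its neighbours form a clique. If `G` has a dominating vertex, the
degree and the card of that vertex determine `G` (`iso_of_dominating`). Otherwise, counting edges
and triangles in the cards shows that a bijection matching the cards preserves degrees and the
numbers `openPairs` of nonadjacent pairs of neighbours. So the deck shows which vertices are
simplicial, and in `G` these are the outer leaves of the tree.

Take a simplicial `v` of least degree, its tree neighbour `u`, and the only non-leaf neighbour `t`
of `u`. The card at `u` allows `H` to be placed on the vertices of `G` so that both agree off `u`;
only the neighbourhood of `u` in `H` is unknown. Minimality gives the edges from `u` to its leaves
(`adj_cls`). If `t` has at least two neighbours besides `u`, then `H` and `G` have the same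
simplicial vertices (`openPairs_iff_of_thick`). If it has only one, the open pairs at `u` take over
that role (`clique_of_thin`).

In both cases a leaf `w` far from `t` is simplicial in `H`, so `H - w`, like `G - w`, is the cube of
a tree (`exists_twoTrees`), and two trees whose cubes agree off `u` are compared. In the thick case
this yields `H = G`. In the thin case `H` may also arise by moving one edge `uy` to `uy₁`
(`ball_one_eq_or_swap`, `thin_agree_or_swap`); the degree sequence then shows that exchanging `y`
and `y₁` is an isomorphism (`iso_of_moved_edge`). -/

namespace TreeCube

/-! ### Tree distances, leaves and outer stars -/

/-- The distance functions of trees, described by the properties used below. Two points at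
distance one are adjacent. -/
structure IsTreeDist {V : Type*} (d : V → V → ℕ) : Prop where
  eq_zero : ∀ x y, d x y = 0 ↔ x = y
  comm : ∀ x y, d x y = d y x
  triangle : ∀ x y z, d x z ≤ d x y + d y z
  adj : ∀ z a b, d a b = 1 → d z a = d z b + 1 ∨ d z b = d z a + 1
  closer : ∀ z a, a ≠ z → ∃ b, d a b = 1 ∧ d z a = d z b + 1
  unique : ∀ z a b b', d a b = 1 → d a b' = 1 → d z a = d z b + 1 → d z a = d z b' + 1 → b = b'

theorem _root_.SimpleGraph.IsTree.isTreeDist {V : Type*} {T : SimpleGraph V} (hT : T.IsTree) :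
    IsTreeDist T.dist where
  eq_zero _ _ := hT.connected.dist_eq_zero_iff
  comm _ _ := SimpleGraph.dist_comm
  triangle _ _ _ := hT.connected.dist_triangle
  adj z a b h := hT.dist_eq_dist_add_one_of_adj z (SimpleGraph.dist_eq_one_iff_adj.1 h)
  closer z a h := by
    obtain ⟨p, hp⟩ := hT.connected.exists_walk_length_eq_dist a z
    cases p with
    | nil => exact absurd rfl h
    | cons hab q =>
      rename_i b
      refine ⟨b, SimpleGraph.dist_eq_one_iff_adj.2 hab, ?_⟩
      have h1 := SimpleGraph.dist_le q
      have h2 := hT.connected.dist_triangle (u := a) (v := b) (w := z)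
      rw [SimpleGraph.dist_eq_one_iff_adj.2 hab] at h2
      rw [SimpleGraph.Walk.length_cons] at hp
      rw [SimpleGraph.dist_comm, SimpleGraph.dist_comm (u := z)]
      omega
  unique z a b b' hab hab' hb hb' := by
    have key : ∀ b, T.dist a b = 1 → T.dist z a = T.dist z b + 1 →
        ∃ p : T.Walk a z, p.IsPath ∧ p.snd = b := by
      intro b hab hb
      obtain ⟨q, hq⟩ := hT.connected.exists_walk_length_eq_dist b z
      refine ⟨.cons (SimpleGraph.dist_eq_one_iff_adj.1 hab) q, ?_, by simp⟩
      apply SimpleGraph.Walk.isPath_of_length_eq_dist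
      rw [SimpleGraph.Walk.length_cons, hq, SimpleGraph.dist_comm, ← hb, SimpleGraph.dist_comm]
    obtain ⟨p, hp, rfl⟩ := key b hab hb
    obtain ⟨q, hq, rfl⟩ := key b' hab' hb'
    have := (hT.isAcyclic.subsingleton_path a z).elim ⟨p, hp⟩ ⟨q, hq⟩
    rw [Subtype.mk.injEq] at this
    rw [this]

theorem power_adj {V : Type*} {T : SimpleGraph V} (hT : T.IsTree) (k : ℕ) (x y : V) :
    (power T k).Adj x y ↔ x ≠ y ∧ T.dist x y ≤ k := by
  change x ≠ y ∧ T.edist x y ≤ k ↔ _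
  rw [← (hT.connected x y).coe_dist_eq_edist, Nat.cast_le]

namespace IsTreeDist

variable {V : Type*} {d : V → V → ℕ}

theorem comp (hd : IsTreeDist d) {W : Type*} (f : W → V) (hf : Function.Injective f)
    (h : ∀ z a, a ≠ z → ∃ b, d (f a) (f b) = 1 ∧ d (f z) (f a) = d (f z) (f b) + 1) :
    IsTreeDist fun x y => d (f x) (f y) where
  eq_zero x y := by rw [hd.eq_zero, hf.eq_iff]
  comm _ _ := hd.comm _ _
  triangle _ _ _ := hd.triangle _ _ _
  adj _ _ _ h := hd.adj _ _ _ h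
  closer := h
  unique z a b b' h1 h2 h3 h4 := hf (hd.unique _ _ _ _ h1 h2 h3 h4)

theorem comp_equiv (hd : IsTreeDist d) {W : Type*} (f : W ≃ V) :
    IsTreeDist fun x y => d (f x) (f y) :=
  hd.comp f f.injective fun z a h => by
    obtain ⟨b, hb⟩ := hd.closer (f z) (f a) (by simpa using h)
    exact ⟨f.symm b, by simpa using hb⟩

theorem self (hd : IsTreeDist d) (x : V) : d x x = 0 := (hd.eq_zero x x).2 rfl

theorem ne_of_pos (hd : IsTreeDist d) {x y : V} (h : 0 < d x y) : x ≠ y := by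
  rintro rfl
  simp [hd.self] at h

theorem pos (hd : IsTreeDist d) {x y : V} (h : x ≠ y) : 0 < d x y :=
  Nat.pos_of_ne_zero fun h0 => h ((hd.eq_zero x y).1 h0)

/-- At most one neighbour of `a` is closer to `z` than `a`. -/
theorem far_of_ne (hd : IsTreeDist d) (z : V) {a b b' : V} (hb : d a b = 1) (hb' : d a b' = 1)
    (h : b ≠ b') : d z b = d z a + 1 ∨ d z b' = d z a + 1 := by
  by_contra hc
  have h1 := hd.adj z a b hb
  have h2 := hd.adj z a b' hb'
  exact h (hd.unique z a b b' hb hb' (by omega) (by omega))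

theorem step (hd : IsTreeDist d) {z a b y : V} (hb : d a b = 1) (hzb : d z a = d z b + 1)
    (hy : d a y = 1) (h : y ≠ b) : d z y = d z a + 1 := by
  have := hd.far_of_ne z hy hb h
  omega

theorem exists_on_path (hd : IsTreeDist d) (z a : V) (k : ℕ) (hk : k ≤ d z a) :
    ∃ b, d a b = k ∧ d z b + k = d z a := by
  induction k with
  | zero => exact ⟨a, hd.self a, rfl⟩
  | succ k ih =>
    obtain ⟨b, hab, hzb⟩ := ih (by omega)
    obtain ⟨b', hbb', hz⟩ := hd.closer z b (hd.ne_of_pos (by omega : 0 < d z b)).symm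
    refine ⟨b', ?_, by omega⟩
    have h1 := hd.triangle a b b'
    have h2 := hd.triangle z b' a
    rw [hd.comm b' a] at h2
    omega

/-- A neighbour `u` is the only neighbour of `x`. -/
def _root_.TreeCube.IsLeafAt (d : V → V → ℕ) (x u : V) : Prop :=
  d x u = 1 ∧ ∀ y, d y x = 1 → y = u

theorem leaf_dist (hd : IsTreeDist d) {x u : V} (h : IsLeafAt d x u) {k : V} (hk : k ≠ x) :
    d k x = d k u + 1 := by
  obtain ⟨b, hb, hkb⟩ := hd.closer k x hk.symm
  rwa [h.2 b (by rw [hd.comm, hb])] at hkb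

/-- `v` is a leaf at `u`, and all neighbours of `u` other than `t` are leaves. -/
structure _root_.TreeCube.IsOuterLeaf (d : V → V → ℕ) (v u t : V) : Prop where
  adj_vu : d v u = 1
  adj_ut : d u t = 1
  ne : v ≠ t
  leaf : ∀ x, d x u = 1 → x ≠ t → IsLeafAt d x u

/-- The first step from `u` towards `k` must go to `t`, since a leaf at `u` is the first step only
towards itself. -/
theorem outer_dist (hd : IsTreeDist d) {v u t : V} (h : IsOuterLeaf d v u t) {k : V} (hk : k ≠ u)
    (hk' : ¬ (d k u = 1 ∧ k ≠ t)) : d k u = d k t + 1 := by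
  obtain ⟨b, hb, hkb⟩ := hd.closer k u hk.symm
  by_cases hbt : b = t
  · rwa [hbt] at hkb
  · have hl := h.leaf b (by rw [hd.comm, hb]) hbt
    by_cases hkb' : k = b
    · subst hkb'
      exact absurd ⟨hl.1, hbt⟩ hk'
    · have := hd.leaf_dist hl hkb'
      omega

theorem _root_.TreeCube.IsOuterLeaf.sibling {v u t x : V} (h : IsOuterLeaf d v u t) (hx : d x u = 1)
    (hxt : x ≠ t) : IsOuterLeaf d x u t := ⟨hx, h.adj_ut, hxt, h.leaf⟩

/-- Everything within 3 of `v` is within 2 of `u`, and at distance exactly 2 only when adjacent to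
`t`. Two vertices of the latter kind meet through `t`, all other pairs through `u`. -/
theorem outer_simplicial (hd : IsTreeDist d) {v u t : V} (h : IsOuterLeaf d v u t) {x y : V}
    (hx : d v x ≤ 3) (hy : d v y ≤ 3) : d x y ≤ 3 := by
  have key : ∀ z, d v z ≤ 3 → d u z ≤ 2 ∧ (d u z = 2 → d t z = 1) := by
    intro z hz
    by_cases hzv : z = v
    · subst hzv
      rw [hd.comm, h.adj_vu]
      omega
    have h1 := hd.leaf_dist (h.leaf v h.adj_vu h.ne) hzv
    rw [hd.comm z v, hd.comm z u] at h1
    refine ⟨by omega, fun h2 => ?_⟩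
    have := hd.outer_dist h (k := z) (by rintro rfl; rw [hd.self] at h2; omega)
      (by rw [hd.comm z u]; omega)
    rw [hd.comm z u, hd.comm z t] at this
    omega
  have hx' := key x hx
  have hy' := key y hy
  have h1 := hd.triangle x u y
  have h2 := hd.triangle x t y
  rw [hd.comm x u] at h1
  rw [hd.comm x t] at h2
  by_cases e : d u x = 2 ∧ d u y = 2
  · have := hx'.2 e.1
    have := hy'.2 e.2
    omega
  · omega

/-- A vertex that is simplicial in the cube and not dominating there is an outer leaf. -/
theorem exists_outer_of_simplicial (hd : IsTreeDist d) {v f : V} (hf : 4 ≤ d v f)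
    (hs : ∀ x y, d v x ≤ 3 → d v y ≤ 3 → d x y ≤ 3) :
    ∃ u t q, IsOuterLeaf d v u t ∧ d v q = 4 ∧ d u q = 3 ∧ d t q = 2 := by
  obtain ⟨q, hq, -⟩ := hd.exists_on_path f v 4 (by rwa [hd.comm])
  have hc := hd.comm
  obtain ⟨u, hu, hqu⟩ := hd.closer q v (hd.ne_of_pos (by omega))
  rw [hc q v, hq, hc q u] at hqu
  obtain ⟨t, ht, hqt⟩ := hd.closer q u (hd.ne_of_pos (by omega))
  rw [hc q u, hc q t] at hqt
  obtain ⟨s, hs', hqs⟩ := hd.closer q t (hd.ne_of_pos (by omega))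
  rw [hc q t, hc q s] at hqs
  have hsv : d s u = 2 := by
    have h1 := hd.triangle s t u
    have h2 := hd.triangle u s q
    have := hc s t
    have := hc t u
    have := hc u s
    omega
  refine ⟨u, t, q, ⟨hu, ht, ?_, ?_⟩, hq, by omega, by omega⟩
  · rintro rfl
    omega
  -- On the path `v, u, t, s, q`, the vertex `s` is within 3 of `v`. So is a vertex `y` behind a
  -- non-leaf neighbour `x ≠ t` of `u`, but `y` is at distance 4 from `s`.
  · intro x hx hxt
    refine ⟨hx, fun y hy => ?_⟩
    by_contra hyu
    have hsx : d s x = 3 := by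
      have := hd.step (z := s) ht (by rw [hsv, hc s t]; omega) (by rw [hc]; exact hx) hxt
      omega
    have hsy : d s y = 4 := by
      have := hd.step (z := s) hx (by omega) (by rw [hc]; exact hy) hyu
      omega
    have hvs : d v s ≤ 3 := by
      have := hd.triangle v u s
      have := hc u s
      omega
    have hvy : d v y ≤ 3 := by
      have := hd.triangle v u y
      have := hd.triangle u x y
      have := hc u x
      have := hc x y
      omega
    have := hs s y hvs hvy
    omega

/-- A vertex at maximal distance from `t` is an outer leaf. -/
theorem exists_outer_of_far (hd : IsTreeDist d) [Finite V] (t : V) {f : V} (hf : 2 ≤ d t f) :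
    ∃ v u s, IsOuterLeaf d v u s ∧ d t f ≤ d t v := by
  have hc := hd.comm
  have : Nonempty V := ⟨t⟩
  obtain ⟨v, hv⟩ := Finite.exists_max (d t)
  have hfv := hv f
  obtain ⟨u, hu, htu⟩ := hd.closer t v (hd.ne_of_pos (by omega)).symm
  obtain ⟨s, hs, hts⟩ := hd.closer t u (hd.ne_of_pos (by omega)).symm
  refine ⟨v, u, s, ⟨hu, hs, ?_, ?_⟩, hfv⟩
  · rintro rfl
    omega
  · intro x hx hxs
    refine ⟨hx, fun y hy => ?_⟩
    by_contra hyu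
    have h1 := hd.step hs hts (by rwa [hc]) hxs
    have h2 := hd.step (z := t) hx (by omega) (by rwa [hc]) hyu
    have := hv y
    omega

end IsTreeDist

/-! ### Degrees and open pairs from the deck -/

section Counting

open Classical in
/-- The adjacency matrix with integer entries. -/
noncomputable def adjInd {V : Type*} (G : SimpleGraph V) (a b : V) : ℤ := if G.Adj a b then 1 else 0

open Classical in
/-- The number of neighbours of `v`. -/
noncomputable def deg {V : Type*} [Fintype V] (G : SimpleGraph V) (v : V) : ℕ :=
  (Finset.univ.filter fun y => G.Adj v y).card

open Classical in
/-- The number of ordered pairs of distinct nonadjacent neighbours of `v`. -/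
noncomputable def openPairs {V : Type*} [Fintype V] (G : SimpleGraph V) (v : V) : ℕ :=
  (Finset.univ.filter fun p : V × V =>
    (G.Adj v p.1 ∧ G.Adj v p.2) ∧ p.1 ≠ p.2 ∧ ¬ G.Adj p.1 p.2).card

/-- The number of ordered adjacent pairs. -/
noncomputable def edgeSum {V : Type*} [Fintype V] (G : SimpleGraph V) : ℤ :=
  ∑ a, ∑ b, adjInd G a b

/-- The number of ordered triangles. -/
noncomputable def triSum {V : Type*} [Fintype V] (G : SimpleGraph V) : ℤ :=
  ∑ a, ∑ b, ∑ c, adjInd G a b * adjInd G b c * adjInd G c a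

/-- The number of ordered triangles starting at `v`. -/
noncomputable def triAt {V : Type*} [Fintype V] (G : SimpleGraph V) (v : V) : ℤ :=
  ∑ b, ∑ c, adjInd G v b * adjInd G b c * adjInd G c v

theorem adjInd_congr {V W : Type*} {G : SimpleGraph V} {H : SimpleGraph W} {a b : V} {a' b' : W}
    (h : G.Adj a b ↔ H.Adj a' b') : adjInd G a b = adjInd H a' b' := by
  by_cases h' : G.Adj a b
  · simp [adjInd, h', h.1 h']
  · simp [adjInd, h', mt h.2 h']

theorem adjInd_comm {V : Type*} (G : SimpleGraph V) (a b : V) : adjInd G a b = adjInd G b a :=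
  adjInd_congr (G.adj_comm a b)

theorem adjInd_self {V : Type*} (G : SimpleGraph V) (a : V) : adjInd G a a = 0 := by
  simp [adjInd]

variable {V W : Type*} [Fintype V] [Fintype W]

theorem sum_ne_eq (f : V → ℤ) (v : V) [Fintype {x // x ≠ v}] :
    ∑ x : {x // x ≠ v}, f x = ∑ x, f x - f v := by
  classical
  rw [← Finset.sum_subtype (Finset.univ.erase v) (by simp),
    ← Finset.sum_erase_add _ _ (Finset.mem_univ v)]
  ring

theorem edgeSum_iso {G : SimpleGraph V} {H : SimpleGraph W} (e : G ≃g H) :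
    edgeSum G = edgeSum H := by
  unfold edgeSum
  rw [← e.toEquiv.sum_comp]
  refine Finset.sum_congr rfl fun a _ => ?_
  rw [← e.toEquiv.sum_comp]
  exact Finset.sum_congr rfl fun b _ => adjInd_congr e.map_adj_iff.symm

theorem triSum_iso {G : SimpleGraph V} {H : SimpleGraph W} (e : G ≃g H) :
    triSum G = triSum H := by
  unfold triSum
  rw [← e.toEquiv.sum_comp]
  refine Finset.sum_congr rfl fun a _ => ?_
  rw [← e.toEquiv.sum_comp]
  refine Finset.sum_congr rfl fun b _ => ?_
  rw [← e.toEquiv.sum_comp]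
  refine Finset.sum_congr rfl fun c _ => ?_
  rw [adjInd_congr (e.map_adj_iff (v := a) (w := b)).symm,
    adjInd_congr (e.map_adj_iff (v := b) (w := c)).symm,
    adjInd_congr (e.map_adj_iff (v := c) (w := a)).symm]
  rfl

theorem deg_eq_sum (G : SimpleGraph V) (v : V) : (deg G v : ℤ) = ∑ y, adjInd G v y := by
  simp [deg, adjInd]

theorem deg_eq_sum' (G : SimpleGraph V) (v : V) : (deg G v : ℤ) = ∑ y, adjInd G y v := by
  simp_rw [deg_eq_sum, adjInd_comm G v]

/-- Among all ordered pairs of neighbours, those with equal entries number `deg` and the adjacent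
ones number `triAt`. -/
theorem openPairs_eq (G : SimpleGraph V) (v : V) :
    (openPairs G v : ℤ) = deg G v * deg G v - deg G v - triAt G v := by
  classical
  have h1 : (openPairs G v : ℤ) = ∑ a, ∑ b,
      (adjInd G v a * adjInd G v b - (if a = b then adjInd G v a else 0)
        - adjInd G v a * adjInd G a b * adjInd G b v) := by
    rw [openPairs, Finset.card_filter, ← Fintype.sum_prod_type']
    push_cast
    refine Finset.sum_congr rfl fun p _ => ?_
    obtain ⟨a, b⟩ := p
    have : G.Adj b v ↔ G.Adj v b := G.adj_comm _ _
    by_cases hab : a = b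
    · subst hab
      by_cases h1 : G.Adj v a <;> simp [adjInd, h1]
    · by_cases h1 : G.Adj v a <;> by_cases h2 : G.Adj v b <;> by_cases h3 : G.Adj a b <;>
        simp [adjInd, h1, h2, h3, hab, this]
  rw [h1]
  simp only [Finset.sum_sub_distrib, Finset.sum_ite_eq, Finset.mem_univ, if_true, triAt]
  rw [deg_eq_sum, Finset.sum_mul_sum]

theorem edgeSum_delete (G : SimpleGraph V) (v : V) [Fintype {x // x ≠ v}] :
    edgeSum (deleteVertex G v) = edgeSum G - 2 * deg G v := by
  have h : edgeSum (deleteVertex G v) =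
      ∑ a : {x // x ≠ v}, ∑ b : {x // x ≠ v}, adjInd G a.1 b.1 :=
    Finset.sum_congr rfl fun a _ => Finset.sum_congr rfl fun b _ => adjInd_congr Iff.rfl
  rw [h, sum_ne_eq (fun a => ∑ b : {x // x ≠ v}, adjInd G a b.1) v]
  simp_rw [fun a => sum_ne_eq (fun b => adjInd G a b) v]
  rw [Finset.sum_sub_distrib, ← deg_eq_sum', ← deg_eq_sum, adjInd_self, edgeSum]
  ring

/-- An ordered triangle through `v` contains it in exactly one of three positions; the terms with
`v` in two positions vanish by `adjInd_self`. -/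
theorem triSum_delete (G : SimpleGraph V) (v : V) [Fintype {x // x ≠ v}] :
    triSum (deleteVertex G v) = triSum G - 3 * triAt G v := by
  have h : triSum (deleteVertex G v) =
      ∑ a : {x // x ≠ v}, ∑ b : {x // x ≠ v}, ∑ c : {x // x ≠ v},
        adjInd G a.1 b.1 * adjInd G b.1 c.1 * adjInd G c.1 a.1 :=
    Finset.sum_congr rfl fun a _ => Finset.sum_congr rfl fun b _ =>
      Finset.sum_congr rfl fun c _ => by
      rw [adjInd_congr (G := deleteVertex G v) (H := G) (a := a) (b := b) Iff.rfl,
        adjInd_congr (G := deleteVertex G v) (H := G) (a := b) (b := c) Iff.rfl,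
        adjInd_congr (G := deleteVertex G v) (H := G) (a := c) (b := a) Iff.rfl]
  rw [h, sum_ne_eq (fun a => ∑ b : {x // x ≠ v}, ∑ c : {x // x ≠ v},
    adjInd G a b.1 * adjInd G b.1 c.1 * adjInd G c.1 a) v]
  simp_rw [fun a => sum_ne_eq (fun b => ∑ c : {x // x ≠ v},
    adjInd G a b * adjInd G b c.1 * adjInd G c.1 a) v,
    fun a b => sum_ne_eq (fun c => adjInd G a b * adjInd G b c * adjInd G c a) v]
  simp only [Finset.sum_sub_distrib, adjInd_self, mul_zero, zero_mul, Finset.sum_const_zero,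
    sub_zero]
  have h1 : ∑ a, ∑ b, adjInd G a b * adjInd G b v * adjInd G v a = triAt G v := by
    unfold triAt
    refine Finset.sum_congr rfl fun a _ => Finset.sum_congr rfl fun b _ => by ring
  have h2 : ∑ a, ∑ c, adjInd G a v * adjInd G v c * adjInd G c a = triAt G v := by
    unfold triAt
    rw [Finset.sum_comm]
    refine Finset.sum_congr rfl fun a _ => Finset.sum_congr rfl fun b _ => by ring
  rw [h1, h2]
  unfold triAt triSum
  ring

theorem openPairs_eq_zero {G : SimpleGraph V} {v : V} :
    openPairs G v = 0 ↔ ∀ a b, G.Adj v a → G.Adj v b → a ≠ b → G.Adj a b := by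
  classical
  simp only [openPairs, Finset.card_eq_zero, Finset.filter_eq_empty_iff, Finset.mem_univ,
    true_implies, Prod.forall, not_and, not_not]
  constructor
  · intro h a b ha hb hab
    exact h a b ⟨ha, hb⟩ hab
  · intro h a b ha hab
    exact h a b ha.1 ha.2 hab

/-- Equal multisets of values mean equinumerous fibres, and bijections between fibres glue. -/
theorem exists_equiv_of_map_eq {γ : Type*} {f : W → γ} {g : V → γ}
    (h : (Finset.univ : Finset W).val.map f = (Finset.univ : Finset V).val.map g) :
    ∃ e : W ≃ V, ∀ w, g (e w) = f w := by
  classical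
  have key : ∀ c, Nonempty ({w // f w = c} ≃ {v // g v = c}) := by
    intro c
    have := congrArg (Multiset.count c) h
    rw [Multiset.count_map, Multiset.count_map, ← Finset.filter_val, ← Finset.filter_val,
      Finset.card_val, Finset.card_val] at this
    rw [← Fintype.card_eq, Fintype.card_subtype, Fintype.card_subtype]
    simpa [eq_comm] using this
  exact ⟨Equiv.ofFiberEquiv fun c => (key c).some, fun w => Equiv.ofFiberEquiv_map _ w⟩

/-- Two graphs with the same deck have a bijection that matches isomorphic cards. -/
theorem exists_matching_of_deck_eq {H : SimpleGraph W} {G : SimpleGraph V}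
    (h : deck H = deck G) :
    ∃ σ : W ≃ V, ∀ w, Nonempty (deleteVertex H w ≃g deleteVertex G (σ w)) := by
  obtain ⟨σ, hσ⟩ := exists_equiv_of_map_eq h
  exact ⟨σ, fun w => (unlabelled_eq_iff _ _).1 (hσ w).symm⟩

/-- Kelly's argument: the edge counts of the `n` cards add up to `n - 2` times that of the graph, so
`n ≥ 3` recovers the total, and comparison with one card gives a degree. -/
theorem deg_eq_of_matching {H : SimpleGraph W} {G : SimpleGraph V} (σ : W ≃ V)
    (hσ : ∀ w, Nonempty (deleteVertex H w ≃g deleteVertex G (σ w)))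
    (hV : 3 ≤ Fintype.card V) (w : W) : deg H w = deg G (σ w) := by
  classical
  have hc : ∀ w, edgeSum H - 2 * deg H w = edgeSum G - 2 * deg G (σ w) := fun w => by
    rw [← edgeSum_delete, ← edgeSum_delete]
    exact edgeSum_iso (hσ w).some
  have htot : edgeSum H = edgeSum G := by
    have := Finset.sum_congr (s₁ := Finset.univ) rfl fun w _ => hc w
    rw [σ.sum_comp fun v => edgeSum G - 2 * (deg G v : ℤ)] at this
    simp only [Finset.sum_sub_distrib, ← Finset.mul_sum, deg_eq_sum, Finset.sum_const,
      Finset.card_univ, nsmul_eq_mul, Fintype.card_congr σ] at this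
    change _ * edgeSum H - 2 * edgeSum H = _ * edgeSum G - 2 * edgeSum G at this
    have h3 : (3 : ℤ) ≤ Fintype.card V := by exact_mod_cast hV
    have h4 : ((Fintype.card V : ℤ) - 2) * edgeSum H = ((Fintype.card V : ℤ) - 2) * edgeSum G := by
      linarith
    exact mul_left_cancel₀ (by omega) h4
  have := hc w
  omega

/-- The same argument for triangles, each of which is missing from three cards; hence the factor `n
- 3` and the need for four vertices. -/
theorem openPairs_eq_of_matching {H : SimpleGraph W} {G : SimpleGraph V} (σ : W ≃ V)
    (hσ : ∀ w, Nonempty (deleteVertex H w ≃g deleteVertex G (σ w)))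
    (hV : 4 ≤ Fintype.card V) (w : W) : openPairs H w = openPairs G (σ w) := by
  classical
  have hc : ∀ w, triSum H - 3 * triAt H w = triSum G - 3 * triAt G (σ w) := fun w => by
    rw [← triSum_delete, ← triSum_delete]
    exact triSum_iso (hσ w).some
  have htot : triSum H = triSum G := by
    have := Finset.sum_congr (s₁ := Finset.univ) rfl fun w _ => hc w
    rw [σ.sum_comp fun v => triSum G - 3 * triAt G v] at this
    simp only [Finset.sum_sub_distrib, ← Finset.mul_sum, triAt, Finset.sum_const,
      Finset.card_univ, nsmul_eq_mul, Fintype.card_congr σ] at this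
    change _ * triSum H - 3 * triSum H = _ * triSum G - 3 * triSum G at this
    have h3 : (4 : ℤ) ≤ Fintype.card V := by exact_mod_cast hV
    have h4 : ((Fintype.card V : ℤ) - 3) * triSum H = ((Fintype.card V : ℤ) - 3) * triSum G := by
      linarith
    exact mul_left_cancel₀ (by omega) h4
  have h1 := hc w
  have h2 := openPairs_eq H w
  have h3 := openPairs_eq G (σ w)
  rw [deg_eq_of_matching σ hσ (by omega) w] at h2
  rw [← Nat.cast_inj (R := ℤ), h2, h3]
  omega

end Counting

/-! ### Recovering balls of radius one from the cube -/

namespace IsTreeDist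

variable {V : Type*} {d : V → V → ℕ}

/-- Two vertices at distance two from `z` that are close to each other have the same neighbour
adjacent to `z`. -/
theorem same_parent (hd : IsTreeDist d) {z p x m : V} (hxp : d x p = 1) (hpz : d p z = 1)
    (hx : d x z = 2) (hm : d m z = 2) (hxm : d x m ≤ 3) : d m p = 1 := by
  have hc := hd.comm
  rcases hd.adj m p z hpz with h | h
  · have hxz : x ≠ z := hd.ne_of_pos (by omega)
    have := hd.step (z := m) hpz h (y := x) (by rw [hc, hxp]) hxz
    have := hc x m
    omega
  · omega

/-- The cube neighbours of the leaf `t` fill the ball of radius two around `z`. The vertices `a` and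
`b` must be at distance exactly 2 from `z`; a vertex at distance 2 that is close to the whole ball
would give them the same parent, hence make them close to each other. -/
theorem ball_one_iff_of_not_clique (hd : IsTreeDist d) {t z a b : V} (ht : IsLeafAt d t z)
    (ha : d a t ≤ 3) (hb : d b t ≤ 3) (hab : ¬ d a b ≤ 3) (x : V) :
    d x z ≤ 1 ↔ d x t ≤ 3 ∧ ∀ m, d m t ≤ 3 → d x m ≤ 3 := by
  have hc := hd.comm
  have hM : ∀ m, d m t ≤ 3 → d m z ≤ 2 := fun m hm => by
    by_cases h : m = t
    · subst h
      have := ht.1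
      omega
    · have := hd.leaf_dist ht h
      omega
  constructor
  · intro hx
    have := hd.triangle x z t
    have := ht.1
    have := hc z t
    refine ⟨by omega, fun m hm => ?_⟩
    have := hM m hm
    have := hd.triangle x z m
    have := hc z m
    omega
  · rintro ⟨hxt, hx⟩
    have hxz := hM x hxt
    by_contra hne
    have hxz2 : d x z = 2 := by omega
    obtain ⟨p, hp, hpz⟩ := hd.closer z x (hd.ne_of_pos (by omega))
    have hpz1 : d p z = 1 := by
      have := hc z x
      have := hc z p
      omega
    have h2 := hd.triangle a z b
    have h3 := hM a ha
    have h4 := hM b hb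
    have := hc z b
    have ha' := hd.same_parent hp hpz1 hxz2 (m := a) (by omega) (hx a ha)
    have hb' := hd.same_parent hp hpz1 hxz2 (m := b) (by omega) (hx b hb)
    have := hd.triangle a p b
    have := hc p b
    omega

/-- If the ball of radius two around `z` is a clique of the cube, then this ball is recovered up to
one neighbour `y` of `z`. -/
theorem exists_center_of_clique (hd : IsTreeDist d) {t z q : V} (ht : IsLeafAt d t z)
    (hq : 3 ≤ d q z) (hcl : ∀ a b, d a t ≤ 3 → d b t ≤ 3 → d a b ≤ 3) :
    ∃ y q', d y z = 1 ∧ d q' y = 1 ∧ q' ≠ z ∧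
      (∀ x, d x y ≤ 1 ↔ d x t ≤ 3 ∧ ∃ m, ¬ d m t ≤ 3 ∧ d x m ≤ 3) ∧
      (∀ x, d x z ≤ 1 ↔ d x t ≤ 3 ∧ (¬ d x y ≤ 1 ∨ x = z ∨ x = y)) := by
  have hc := hd.comm
  have hM : ∀ m, d m t ≤ 3 ↔ d m z ≤ 2 := fun m => by
    by_cases h : m = t
    · subst h
      have := ht.1
      have := hd.self m
      omega
    · have := hd.leaf_dist ht h
      omega
  simp only [hM] at hcl ⊢
  obtain ⟨y, hy, hqy⟩ := hd.closer q z (hd.ne_of_pos (by omega)).symm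
  obtain ⟨q', hq', hqq'⟩ := hd.closer q y (hd.ne_of_pos (by omega)).symm
  obtain ⟨q3, hq3, hqq3⟩ := hd.exists_on_path q z 3 hq
  have hyz : d y z = 1 := by rw [hc, hy]
  have hq'y : d q' y = 1 := by rw [hc, hq']
  have hq'z : d q' z = 2 := by
    have := hd.triangle q q' z
    have := hd.triangle q' y z
    omega
  -- In the clique case all vertices at distance 2 from `z` hang from `y`, hence so does everything
  -- beyond them.
  have hpar : ∀ m, d m z = 2 → d m y = 1 := fun m hm =>
    hd.same_parent hq'y hyz hq'z hm (hcl _ _ (by omega) (by omega))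
  have htow : ∀ m, 2 ≤ d m z → d m z = d m y + 1 := by
    intro m hm
    obtain ⟨b, hb, hmb⟩ := hd.exists_on_path m z 2 hm
    have := hpar b (by rw [hc, hb])
    have := hd.triangle m b y
    have := hd.adj m y z hyz
    omega
  have hq3z := hc z q3
  have hq3y := htow q3 (by omega)
  refine ⟨y, q', hyz, hq'y, hd.ne_of_pos (by omega), fun x => ⟨fun hx => ⟨?_, q3, ?_, ?_⟩, ?_⟩,
    fun x => ⟨fun hx => ⟨by omega, ?_⟩, ?_⟩⟩
  · have := hd.triangle x y z
    omega
  · omega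
  · have := hd.triangle x y q3
    have := hc y q3
    omega
  · rintro ⟨hx, m, hm, hxm⟩
    by_contra hxy
    have hne : d x z ≠ 2 := fun h => by
      have := hpar x h
      omega
    have hxz : x ≠ z := by
      rintro rfl
      have := hc x y
      omega
    have hxz1 : d x z = 1 := by
      have := hd.pos hxz
      omega
    have := hd.step (z := m) hy (htow m (by omega)) (y := x) (by rw [hc, hxz1])
      (by rintro rfl; rw [hd.self] at hxy; omega)
    have := hc x m
    omega
  · by_contra hcon
    push Not at hcon
    obtain ⟨h1, h2, h3⟩ := hcon
    have := hd.pos h2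
    have := hd.pos h3
    have := hd.adj x y z hyz
    omega
  · rintro ⟨hx, hx'⟩
    by_contra hxz
    have h := hpar x (by omega)
    have h2 := hd.pos (x := x) (y := z) (hd.ne_of_pos (by omega))
    rcases hx' with hx' | rfl | rfl
    · omega
    · rw [hd.self] at hxz
      omega
    · omega

/-- If the same set is a ball of radius one in two trees with the same cube, but with different
centers, then the first center is dominating in the cube. -/
theorem dominating_of_ball_one {e : V → V → ℕ} (hd : IsTreeDist d) (he : IsTreeDist e)
    (hde : ∀ x y, d x y ≤ 3 ↔ e x y ≤ 3) {y y₁ z q : V} (hyz : d y z = 1) (hqy : d q y = 1)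
    (hqz : q ≠ z) (hK : ∀ x, d x y ≤ 1 ↔ e x y₁ ≤ 1) (hne : y ≠ y₁) (x : V) : d x y ≤ 3 := by
  have hc := hd.comm
  by_contra hx
  obtain ⟨w, hw, -⟩ := hd.exists_on_path x y 4 (by omega)
  have hwy := hc w y
  obtain ⟨y', hy', hwy'⟩ := hd.closer w y (hd.ne_of_pos (by omega))
  have hwy'' := hc w y'
  obtain ⟨x3, hx3, hyx3⟩ := hd.closer y' w (hd.ne_of_pos (by omega))
  have hx3y : d x3 y = 3 := by
    have := hd.triangle w x3 y
    have := hd.triangle x3 y' y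
    have := hc x3 y'
    have := hc y' y
    omega
  have hx3y' : d x3 y' = 2 := by
    have := hc x3 y'
    omega
  -- Within the ball around `y`, the vertex `x3` sees in the cube only `y` and `y'`, and `w` only
  -- `y'`.
  have hA : ∀ k, d k y ≤ 1 → d x3 k ≤ 3 → k = y ∨ k = y' := by
    intro k hk hk3
    by_contra hcon
    push Not at hcon
    have := hd.pos hcon.1
    have := hd.step (z := x3) hy' (by omega) (y := k) (by rw [hc]; omega) hcon.2
    omega
  have hB : ∀ k, d k y ≤ 1 → d w k ≤ 3 → k = y' := by
    intro k hk hk3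
    by_contra hcon
    have hky : k ≠ y := by
      rintro rfl
      omega
    have := hd.pos hky
    have := hd.step (z := w) hy' (by omega) (y := k) (by rw [hc]; omega) hcon
    omega
  have hy'y : d y' y = 1 := by rw [hc, hy']
  -- A third point `k` of the ball, not seen by `x3`, forces `e x3 y₁ ≥ 3`. Two neighbours of `y₁`
  -- cannot both be within 3 of `x3`, so `y' = y₁`. But then the first step from `y'` towards `w` in
  -- the second tree is another point of the ball seen by `w`, against `hB`.
  obtain ⟨k, hky, hk1, hk2⟩ : ∃ k, d k y ≤ 1 ∧ k ≠ y ∧ k ≠ y' := by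
    by_cases h : z = y'
    · subst h
      exact ⟨q, by omega, hd.ne_of_pos (by omega), hqz⟩
    · exact ⟨z, by rw [hc]; omega, (hd.ne_of_pos (by omega)).symm, h⟩
  have hk3 : ¬ e x3 k ≤ 3 := fun h => by
    rcases hA k hky ((hde _ _).2 h) with h | h
    · exact hk1 h
    · exact hk2 h
  have hec := he.comm
  have hx3y₁ : 3 ≤ e x3 y₁ := by
    have := (hK k).1 hky
    have := he.triangle x3 y₁ k
    have := hec y₁ k
    omega
  have e1 := (hK y).1 (by rw [hd.self]; omega)
  have e2 := (hK y').1 (by omega)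
  have e3 := (hde x3 y).1 (by omega)
  have e4 := (hde x3 y').1 (by omega)
  have hyy' : y ≠ y' := (hd.ne_of_pos (by omega)).symm
  have hy₁ : y' = y₁ := by
    by_contra h
    have := he.pos h
    have := he.pos hne
    have := hec y y₁
    have := hec y' y₁
    have := he.far_of_ne x3 (a := y₁) (b := y) (b' := y') (by omega) (by omega) hyy'
    omega
  subst hy₁
  have f1 := (hde w y').1 (by omega)
  have f2 : ¬ e w y ≤ 3 := fun h => by
    have := (hde w y).2 h
    omega
  have f3 := he.triangle w y' y
  have f4 := hec y y'
  obtain ⟨b, hb, hwb⟩ := he.closer w y' ((he.ne_of_pos (by omega)).symm)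
  have := hB b ((hK b).2 (by rw [hec]; omega)) ((hde _ _).2 (by omega))
  subst this
  rw [he.self] at hb
  omega

/-- Two trees with the same cube that share a leaf `t` and its neighbour `z` have the same
neighbourhood of `z`, up to a pair of vertices that dominate the cube. -/
theorem ball_one_eq_or_swap {e : V → V → ℕ} (hd : IsTreeDist d) (he : IsTreeDist e)
    (hde : ∀ x y, d x y ≤ 3 ↔ e x y ≤ 3) {t z q : V} (ht : IsLeafAt d t z) (ht' : IsLeafAt e t z)
    (hq : 3 ≤ d q z) :
    (∀ x, d x z ≤ 1 ↔ e x z ≤ 1) ∨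
      ∃ y y₁, y ≠ y₁ ∧ (∀ x, d x y ≤ 3 ∧ d x y₁ ≤ 3) ∧ d y z = 1 ∧ e y₁ z = 1 ∧
        ¬ d y₁ z ≤ 1 ∧ ¬ e y z ≤ 1 ∧ ∀ x, x ≠ y → x ≠ y₁ → (d x z ≤ 1 ↔ e x z ≤ 1) := by
  -- Both descriptions of the ball around `z` use only the cube, except that the clique case also
  -- involves `y`; the ball around `y`, though not its centre, is again determined by the cube.
  by_cases hcl : ∀ a b, d a t ≤ 3 → d b t ≤ 3 → d a b ≤ 3
  · have hcl' : ∀ a b, e a t ≤ 3 → e b t ≤ 3 → e a b ≤ 3 := by simpa only [hde] using hcl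
    have hq' : 3 ≤ e q z := by
      have h1 := hd.leaf_dist ht (k := q) (by rintro rfl; have := ht.1; omega)
      have h2 : ¬ e q t ≤ 3 := fun h => by
        have := (hde _ _).2 h
        omega
      have := he.triangle q z t
      have := he.comm z t
      have := ht'.1
      omega
    obtain ⟨y, p, hyz, hpy, hpz, hK, hN⟩ := hd.exists_center_of_clique ht hq hcl
    obtain ⟨y₁, p₁, hyz₁, hpy₁, hpz₁, hK₁, hN₁⟩ := he.exists_center_of_clique ht' hq' hcl'
    have hKK : ∀ x, d x y ≤ 1 ↔ e x y₁ ≤ 1 := fun x => by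
      rw [hK, hK₁]
      simp only [hde]
    by_cases hyy : y = y₁
    · subst hyy
      left
      intro x
      rw [hN, hN₁, hKK, hde]
    · right
      refine ⟨y, y₁, hyy, fun x => ⟨?_, ?_⟩, hyz, hyz₁, ?_, ?_, ?_⟩
      · exact dominating_of_ball_one hd he hde hyz hpy hpz hKK hyy x
      · rw [hde]
        exact dominating_of_ball_one he hd (fun x y => (hde x y).symm) hyz₁ hpy₁ hpz₁
          (fun x => (hKK x).symm) (Ne.symm hyy) x
      · have h1 := (hKK y₁).2 (by rw [he.self]; omega)
        have := he.ne_of_pos (x := y₁) (y := z) (by omega)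
        rw [hN]
        tauto
      · have h1 := (hKK y).1 (by rw [hd.self]; omega)
        have := hd.ne_of_pos (x := y) (y := z) (by omega)
        rw [hN₁]
        tauto
      · intro x h1 h2
        rw [hN, hN₁, hKK, hde]
        tauto
  · left
    push Not at hcl
    obtain ⟨a, b, ha, hb, hab⟩ := hcl
    intro x
    rw [hd.ball_one_iff_of_not_clique ht ha hb (by omega),
      he.ball_one_iff_of_not_clique ht' ((hde _ _).1 ha) ((hde _ _).1 hb)
        (by rw [← hde]; omega)]
    simp only [hde]

/-- Paths from a leaf at `u` pass through `u`. In particular all leaves at `u` are twins in the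
cube. -/
theorem outer_le_three (hd : IsTreeDist d) {v u t x : V} (h : IsOuterLeaf d v u t)
    (hx : d x u = 1) (hxt : x ≠ t) (y : V) : d y x ≤ 3 ↔ d y u ≤ 2 := by
  by_cases hyx : y = x
  · subst hyx
    have := hd.self y
    omega
  · have := hd.leaf_dist (h.leaf x hx hxt) hyx
    omega

theorem outer_center_le_three (hd : IsTreeDist d) {v u t : V} (h : IsOuterLeaf d v u t) (y : V) :
    d y u ≤ 3 ↔ d y t ≤ 2 := by
  have hut := h.adj_ut
  by_cases hyu : y = u
  · subst hyu
    have := hd.self y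
    omega
  by_cases hy : d y u = 1 ∧ y ≠ t
  · have := hd.triangle y u t
    omega
  · have := hd.outer_dist h hyu hy
    omega

theorem outer_le_one (hd : IsTreeDist d) {v u t y : V} (h : IsOuterLeaf d v u t) (hy : d y u ≤ 2)
    (hyu : y ≠ u) (hyt : ¬ (d y u = 1 ∧ y ≠ t)) : d y t ≤ 1 := by
  have := hd.outer_dist h hyu hyt
  omega

/-- A leaf lies inside no shortest path, so the distance restricts to the other vertices. In
`delete_outer` the same is true of a whole outer star. -/
theorem delete_leaf (hd : IsTreeDist d) {x u : V} (h : IsLeafAt d x u) :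
    IsTreeDist fun a b : {y // y ≠ x} => d a.1 b.1 := by
  refine hd.comp Subtype.val Subtype.val_injective fun z a haz => ?_
  obtain ⟨b, hb, hzb⟩ := hd.closer z.1 a.1 fun e => haz (Subtype.ext e)
  refine ⟨⟨b, ?_⟩, hb, hzb⟩
  rintro rfl
  have h1 := hd.leaf_dist h z.2
  have := h.2 _ hb
  rw [this] at hzb
  omega

theorem delete_outer (hd : IsTreeDist d) {v u t : V} (h : IsOuterLeaf d v u t) {P : V → Prop}
    (hP : ∀ x, P x ↔ x ≠ u ∧ ¬ (d x u = 1 ∧ x ≠ t)) :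
    IsTreeDist fun a b : {y // P y} => d a.1 b.1 := by
  refine hd.comp Subtype.val Subtype.val_injective fun z a haz => ?_
  obtain ⟨b, hb, hzb⟩ := hd.closer z.1 a.1 fun e => haz (Subtype.ext e)
  have hz := (hP z.1).1 z.2
  have ha := (hP a.1).1 a.2
  refine ⟨⟨b, (hP b).2 ⟨?_, ?_⟩⟩, hb, hzb⟩
  · rintro rfl
    have h1 := hd.outer_dist h hz.1 hz.2
    have : a.1 = t := by
      by_contra hat
      exact ha.2 ⟨hb, hat⟩
    rw [this] at hzb
    omega
  · rintro ⟨h1, h2⟩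
    exact ha.1 ((h.leaf b h1 h2).2 _ hb)

theorem _root_.TreeCube.IsOuterLeaf.restrict {v u t : V} (h : IsOuterLeaf d v u t) {P : V → Prop}
    (hv : P v) (hu : P u) (ht : P t) :
    IsOuterLeaf (fun a b : {y // P y} => d a.1 b.1) ⟨v, hv⟩ ⟨u, hu⟩ ⟨t, ht⟩ where
  adj_vu := h.adj_vu
  adj_ut := h.adj_ut
  ne e := h.ne (congrArg Subtype.val e)
  leaf x hx hxt := by
    have := h.leaf x.1 hx fun e => hxt (Subtype.ext e)
    exact ⟨this.1, fun y hy => Subtype.ext (this.2 _ hy)⟩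

/-- The distances to `u` and to `z` if `t` has only the neighbours `u` and `z`. -/
theorem thin_dist (hd : IsTreeDist d) {v u t z : V} (h : IsOuterLeaf d v u t)
    (ht : ∀ k, d k t = 1 → k = u ∨ k = z) {x : V} (hx : x ≠ u) (hx' : ¬ (d x u = 1 ∧ x ≠ t))
    (hxt : x ≠ t) : d x u = d x z + 2 ∧ d x t = d x z + 1 := by
  have h1 := hd.outer_dist h hx hx'
  obtain ⟨b, hb, hxb⟩ := hd.closer x t hxt.symm
  rcases ht b (by rw [hd.comm, hb]) with rfl | rfl
  · omega
  · omega

theorem thin_center (hd : IsTreeDist d) {v u t z : V} (h : IsOuterLeaf d v u t) (htz : d t z = 1)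
    (ht : ∀ k, d k t = 1 → k = u ∨ k = z) {x : V} (hx : x ≠ u) (hx' : ¬ (d x u = 1 ∧ x ≠ t)) :
    d x u ≤ 3 ↔ d x z ≤ 1 := by
  by_cases hxt : x = t
  · subst hxt
    have := h.adj_ut
    have := hd.comm u x
    omega
  · have := hd.thin_dist h ht hx hx' hxt
    omega

/-- Two trees whose cubes agree off the center `u` of a common outer star with a common tail `t`,
`z` agree up to one exchange in the neighbourhood of `u`. -/
theorem thin_agree_or_swap {e : V → V → ℕ} (hd : IsTreeDist d) (he : IsTreeDist e) {v u t z q : V}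
    (h : IsOuterLeaf d v u t) (h' : IsOuterLeaf e v u t)
    (hcls : ∀ x, x ≠ t → (d x u = 1 ↔ e x u = 1)) (htz : d t z = 1) (htz' : e t z = 1)
    (hzu : z ≠ u) (ht : ∀ k, d k t = 1 → k = u ∨ k = z) (ht' : ∀ k, e k t = 1 → k = u ∨ k = z)
    (hde : ∀ x y, x ≠ u → y ≠ u → (d x y ≤ 3 ↔ e x y ≤ 3)) (hqz : 3 ≤ d q z) (hqu : q ≠ u)
    (hq : ¬ (d q u = 1 ∧ q ≠ t)) :
    (∀ x, d x u ≤ 3 ↔ e x u ≤ 3) ∨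
      ∃ y y₁, y ≠ y₁ ∧ y ≠ u ∧ y₁ ≠ u ∧ d y u ≤ 3 ∧ ¬ d y₁ u ≤ 3 ∧ ¬ e y u ≤ 3 ∧ e y₁ u ≤ 3 ∧
        (∀ x, x ≠ y → x ≠ y₁ → (d x u ≤ 3 ↔ e x u ≤ 3)) ∧
        ∀ x, x ≠ u → (d x y ≤ 3 ↔ d x y₁ ≤ 3) := by
  -- Cutting off the outer star turns `t` into a leaf at `z` in both trees, and `thin_center`
  -- translates the ball around `z` into the cube neighbourhood of `u`.
  let P : V → Prop := fun x => x ≠ u ∧ ¬ (d x u = 1 ∧ x ≠ t)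
  have hPd : ∀ x, P x ↔ x ≠ u ∧ ¬ (d x u = 1 ∧ x ≠ t) := fun x => Iff.rfl
  have hPe : ∀ x, P x ↔ x ≠ u ∧ ¬ (e x u = 1 ∧ x ≠ t) := fun x => by
    rw [hPd]
    have := hcls x
    tauto
  have hut := h.adj_ut
  have htu := hd.comm t u
  have hPt : P t := ⟨hd.ne_of_pos (by omega), by tauto⟩
  have hzt : z ≠ t := (hd.ne_of_pos (by omega)).symm
  have hzt1 := hd.comm z t
  have hzu2 : d z u = 2 := by
    have h1 := hd.adj z u t hut
    have := hd.pos hzu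
    omega
  have hPz : P z := ⟨hzu, by omega⟩
  have key := ball_one_eq_or_swap (hd.delete_outer h hPd) (he.delete_outer h' hPe)
    (fun x y => hde x.1 y.1 ((hPd _).1 x.2).1 ((hPd _).1 y.2).1) (t := ⟨t, hPt⟩) (z := ⟨z, hPz⟩)
    (q := ⟨q, hqu, hq⟩)
    ⟨htz, fun y hy => Subtype.ext ((ht y.1 hy).resolve_left ((hPd _).1 y.2).1)⟩
    ⟨htz', fun y hy => Subtype.ext ((ht' y.1 hy).resolve_left ((hPd _).1 y.2).1)⟩ hqz
  simp only [Subtype.forall, Subtype.exists, Subtype.mk.injEq, ne_eq] at key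
  have hcd : ∀ x, P x → (d x u ≤ 3 ↔ d x z ≤ 1) := fun x hx =>
    hd.thin_center h htz ht ((hPd x).1 hx).1 ((hPd x).1 hx).2
  have hce : ∀ x, P x → (e x u ≤ 3 ↔ e x z ≤ 1) := fun x hx =>
    he.thin_center h' htz' ht' ((hPe x).1 hx).1 ((hPe x).1 hx).2
  have hnot : ∀ x, ¬ P x → (d x u ≤ 3 ∧ e x u ≤ 3) := by
    intro x hx
    by_cases hxu : x = u
    · subst hxu
      have := hd.self x
      have := he.self x
      omega
    · have h1 : d x u = 1 ∧ x ≠ t := by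
        by_contra hc
        exact hx ⟨hxu, hc⟩
      have := (hcls x h1.2).1 h1.1
      omega
  rcases key with key | ⟨y, hy, y₁, hy₁, hne, hdom, a1, a2, a3, a4, hoff⟩
  · left
    intro x
    by_cases hx : P x
    · rw [hcd x hx, hce x hx, key x hx]
    · exact iff_of_true (hnot x hx).1 (hnot x hx).2
  · right
    refine ⟨y, y₁, hne, hy.1, hy₁.1, ?_, ?_, ?_, ?_, ?_, ?_⟩
    · rw [hcd y hy]
      omega
    · rw [hcd y₁ hy₁]
      omega
    · rw [hce y hy]
      omega
    · rw [hce y₁ hy₁]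
      omega
    · intro x h1 h2
      by_cases hx : P x
      · rw [hcd x hx, hce x hx, hoff x hx h1 h2]
      · exact iff_of_true (hnot x hx).1 (hnot x hx).2
    · intro x hxu
      by_cases hx : P x
      · exact iff_of_true (hdom x hx).1 (hdom x hx).2
      · have hxc : d x u = 1 ∧ x ≠ t := by
          by_contra hc
          exact hx ⟨hxu, hc⟩
        -- The leaves at `u` see neither `y` nor `y₁`, because both are at distance at least 3 from
        -- `u`.
        have far : ∀ w, P w → 1 ≤ d w z → w ≠ t → ¬ d x w ≤ 3 := by
          intro w hw hwz hwt
          have h1 := hd.thin_dist h ht hw.1 hw.2 hwt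
          have h2 := hd.outer_le_three h hxc.1 hxc.2 w
          rw [hd.comm w x] at h2
          omega
        have f1 := far y hy (by omega) (by
          rintro rfl
          have := (hce y hy).not.2 a4
          have := h'.adj_ut
          have := he.comm u y
          omega)
        have f2 := far y₁ hy₁ (by omega) (by rintro rfl; omega)
        exact iff_of_false f1 f2

end IsTreeDist

/-! ### Two graphs sharing the card at `u` -/

/-- An isomorphism of cards extends to a bijection of the vertex sets. -/
theorem exists_equiv_of_card_iso {V W : Type*} {H : SimpleGraph W} {G : SimpleGraph V} {w : W}
    {v : V} (φ : deleteVertex H w ≃g deleteVertex G v) :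
    ∃ τ : W ≃ V, τ w = v ∧ ∀ x y, x ≠ w → y ≠ w → (H.Adj x y ↔ G.Adj (τ x) (τ y)) := by
  classical
  refine ⟨⟨fun x => if h : x = w then v else (φ ⟨x, h⟩).1,
    fun y => if h : y = v then w else (φ.symm ⟨y, h⟩).1, fun x => ?_, fun y => ?_⟩, by simp, ?_⟩
  · by_cases h : x = w
    · simp [h]
    · have := (φ ⟨x, h⟩).2
      simp [h, this]
  · by_cases h : y = v
    · simp [h]
    · have := (φ.symm ⟨y, h⟩).2
      simp [h, this]
  · intro x y hx hy
    have := φ.map_adj_iff (v := ⟨x, hx⟩) (w := ⟨y, hy⟩)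
    simp only [Equiv.coe_fn_mk, hx, hy, dif_neg, not_false_iff]
    exact this.symm

theorem deg_eq_card {V : Type*} [Fintype V] (G : SimpleGraph V) (v : V)
    [DecidablePred (G.Adj v)] : deg G v = (Finset.univ.filter (G.Adj v)).card := by
  unfold deg
  congr

theorem deg_add_one {V : Type*} [Fintype V] {G : SimpleGraph V} {x : V} {p : V → Prop}
    [DecidablePred p] (hp : ∀ y, p y ↔ y = x ∨ G.Adj x y) :
    deg G x + 1 = (Finset.univ.filter p).card := by
  classical
  rw [deg_eq_card, ← Finset.card_insert_of_notMem (a := x) (by simp)]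
  congr 1
  ext y
  simp [hp]

/-- Two graphs `G`, `H` with matching cards that agree off `u`, where `G` is the cube of a tree and
`u` is the center of an outer star with tail `t` and a leaf `v`. -/
structure CommonCard {V : Type*} [Fintype V] (d : V → V → ℕ) (G H : SimpleGraph V) (σ : V ≃ V)
    (v u t : V) : Prop where
  tree : IsTreeDist d
  adj : ∀ x y, G.Adj x y ↔ x ≠ y ∧ d x y ≤ 3
  outer : IsOuterLeaf d v u t
  far : ∀ x, ∃ f, 4 ≤ d x f
  agree : ∀ x y, x ≠ u → y ≠ u → (H.Adj x y ↔ G.Adj x y)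
  fixed : σ u = u
  deg_eq : ∀ x, deg H x = deg G (σ x)
  openPairs_eq : ∀ x, openPairs H x = openPairs G (σ x)
  minimal : ∀ x, openPairs G x = 0 → deg G v ≤ deg G x

namespace CommonCard

variable {V : Type*} [Fintype V] {d : V → V → ℕ} {G H : SimpleGraph V} {σ : V ≃ V} {v u t : V}

theorem adj_of_le (S : CommonCard d G H σ v u t) {x y : V} (hx : x ≠ u) (hy : y ≠ u) (hxy : x ≠ y)
    (h : d x y ≤ 3) : H.Adj x y := (S.agree x y hx hy).2 ((S.adj x y).2 ⟨hxy, h⟩)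

theorem le_of_adj (S : CommonCard d G H σ v u t) {x y : V} (hx : x ≠ u) (hy : y ≠ u)
    (h : H.Adj x y) : d x y ≤ 3 := ((S.adj x y).1 ((S.agree x y hx hy).1 h)).2

theorem openPairs_cls (S : CommonCard d G H σ v u t) {x : V} (hx : d x u = 1) (hxt : x ≠ t) :
    openPairs G x = 0 := by
  rw [openPairs_eq_zero]
  intro a b ha hb hab
  rw [S.adj] at ha hb ⊢
  exact ⟨hab, S.tree.outer_simplicial (S.outer.sibling hx hxt) ha.2 hb.2⟩

theorem deg_cls (S : CommonCard d G H σ v u t) {x : V} (hx : d x u = 1) (hxt : x ≠ t) :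
    deg G x = deg G v := by
  have key : ∀ x, d x u = 1 → x ≠ t →
      deg G x + 1 = (Finset.univ.filter fun y => d y u ≤ 2).card := fun x hx hxt => by
    refine deg_add_one fun y => ?_
    rw [← S.tree.outer_le_three S.outer hx hxt, S.adj, S.tree.comm x y]
    by_cases h : y = x
    · subst h
      simp [S.tree.self]
    · simp [h, Ne.symm h]
  have h1 := key x hx hxt
  have h2 := key v S.outer.adj_vu S.outer.ne
  omega

theorem exists_far_tail (S : CommonCard d G H σ v u t) :
    ∃ q, d v q = 4 ∧ d u q = 3 ∧ d t q = 2 := by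
  have hc := S.tree.comm
  obtain ⟨f, hf⟩ := S.far v
  obtain ⟨q, hq, -⟩ := S.tree.exists_on_path f v 4 (by rwa [hc])
  have h1 := S.tree.leaf_dist (S.outer.leaf v S.outer.adj_vu S.outer.ne) (k := q)
    (S.tree.ne_of_pos (by omega)).symm
  have := hc q v
  have := hc q u
  have h2 := S.tree.outer_dist S.outer (k := q) (S.tree.ne_of_pos (by omega)) (by omega)
  have := hc q t
  exact ⟨q, hq, by omega, by omega⟩

/-- The leaves at `u` are adjacent to `u` in `H`, by minimality of the degree of `v`. -/
theorem adj_cls (S : CommonCard d G H σ v u t) {x : V} (hx : d x u = 1) (hxt : x ≠ t) :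
    H.Adj u x := by
  classical
  by_contra hux
  have hxu : x ≠ u := S.tree.ne_of_pos (by omega)
  -- Without the edge to `u`, the neighbourhood of `x` in `H` is the clique from `G` with `u`
  -- removed. Then `σ x` is simplicial in `G` and has smaller degree than `v`.
  have hN : ∀ y, H.Adj x y ↔ y ≠ u ∧ G.Adj x y := by
    intro y
    by_cases hy : y = u
    · subst hy
      simp [H.adj_comm x y, hux]
    · simp [hy, S.agree x y hxu hy]
  have hs : openPairs H x = 0 := by
    rw [openPairs_eq_zero]
    intro a b ha hb hab
    rw [hN] at ha hb
    rw [S.agree a b ha.1 hb.1]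
    exact openPairs_eq_zero.1 (S.openPairs_cls hx hxt) a b ha.2 hb.2 hab
  have hlt : deg H x < deg G x := by
    rw [deg_eq_card, deg_eq_card]
    refine Finset.card_lt_card (Finset.ssubset_iff_of_subset (fun y => ?_) |>.2 ⟨u, ?_, ?_⟩)
    · simp [hN]
    · simp [S.adj, hxu, hx]
    · simp [hN]
  have h1 := S.minimal (σ x) (by rw [← S.openPairs_eq, hs])
  rw [← S.deg_eq, ← S.deg_cls hx hxt] at h1
  omega

/-- If `x` is simplicial in `H` but not in `G`, a nonadjacent pair of its neighbours in `G` has the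
form `u, f`. One of `k₁`, `k₂` is farther from `f` than `t` is and can replace `u`, which gives a
nonadjacent pair off `u`, where the graphs agree. So simplicial in `H` implies simplicial in `G`,
and `σ` shows that both graphs have equally many simplicial vertices. -/
theorem openPairs_iff_of_thick (S : CommonCard d G H σ v u t) {k₁ k₂ : V} (hk : k₁ ≠ k₂)
    (h₁ : d t k₁ = 1) (h₂ : d t k₂ = 1) (hu₁ : k₁ ≠ u) (hu₂ : k₂ ≠ u) (x : V) :
    openPairs H x = 0 ↔ openPairs G x = 0 := by
  classical
  have hd := S.tree
  have hc := hd.comm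
  have hGu : openPairs G u ≠ 0 := by
    obtain ⟨q, hvq, huq, htq⟩ := S.exists_far_tail
    rw [Ne, openPairs_eq_zero]
    intro h
    have h1 := h v q ((S.adj _ _).2 ⟨(hd.ne_of_pos (by rw [S.outer.adj_vu]; omega)).symm, by
      rw [hc, S.outer.adj_vu]; omega⟩) ((S.adj _ _).2 ⟨hd.ne_of_pos (by omega), by omega⟩)
      (hd.ne_of_pos (by omega))
    have := ((S.adj _ _).1 h1).2
    omega
  have hHu : openPairs H u ≠ 0 := by rwa [S.openPairs_eq, S.fixed]
  have key : ∀ x f, x ≠ u → f ≠ u → openPairs H x = 0 → d x u ≤ 3 → d x f ≤ 3 → 4 ≤ d u f →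
      d x f = 0 := by
    intro x f hxu hfu hs hx hxf hf
    by_contra hne
    have hxf' : x ≠ f := hd.ne_of_pos (Nat.pos_of_ne_zero hne)
    have hfu' := hc f u
    have hfx := hc f x
    by_cases hxc : d x u = 1 ∧ x ≠ t
    · have := hd.outer_le_three S.outer hxc.1 hxc.2 f
      omega
    have e1 := hd.outer_dist S.outer hxu hxc
    have e2 := hd.outer_dist S.outer hfu (by omega)
    obtain ⟨k, hk, hku, hfk⟩ : ∃ k, d t k = 1 ∧ k ≠ u ∧ d f k = d f t + 1 := by
      rcases hd.far_of_ne f h₁ h₂ hk with h | h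
      · exact ⟨k₁, h₁, hu₁, h⟩
      · exact ⟨k₂, h₂, hu₂, h⟩
    have h1 := hd.triangle x t k
    have hkx : x ≠ k := by
      rintro rfl
      omega
    have hkf : k ≠ f := by
      rintro rfl
      rw [hd.self] at hfk
      omega
    have := openPairs_eq_zero.1 hs k f (S.adj_of_le hxu hku hkx (by omega))
      (S.adj_of_le hxu hfu hxf' hxf) hkf
    have := S.le_of_adj hku hfu this
    have := hc k f
    omega
  have hsub : ∀ x, openPairs H x = 0 → openPairs G x = 0 := by
    intro x hs
    have hxu : x ≠ u := by
      rintro rfl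
      exact hHu hs
    rw [openPairs_eq_zero]
    intro a b ha hb hab
    rw [S.adj] at ha hb ⊢
    refine ⟨hab, ?_⟩
    by_contra hab3
    by_cases hau : a = u
    · subst hau
      exact hb.1 ((hd.eq_zero _ _).1 (key x b hxu hab.symm hs ha.2 hb.2 (by omega)))
    by_cases hbu : b = u
    · subst hbu
      have := hc a b
      exact ha.1 ((hd.eq_zero _ _).1 (key x a hxu hab hs hb.2 ha.2 (by omega)))
    have := openPairs_eq_zero.1 hs a b (S.adj_of_le hxu hau ha.1 ha.2)
      (S.adj_of_le hxu hbu hb.1 hb.2) hab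
    exact hab3 (S.le_of_adj hau hbu this)
  have heq : (Finset.univ.filter fun x => openPairs H x = 0) =
      Finset.univ.filter fun x => openPairs G x = 0 := by
    refine Finset.eq_of_subset_of_card_le (fun x => by simpa using hsub x) (le_of_eq ?_)
    refine Finset.card_bij (fun x _ => σ.symm x) ?_ (fun a _ b _ h => by simpa using h) ?_
    · intro x hx
      simpa [S.openPairs_eq] using hx
    · intro y hy
      exact ⟨σ y, by simpa [S.openPairs_eq] using hy, by simp⟩
  simpa using congrArg (x ∈ ·) heq

/-- If `t` has only the neighbours `u` and `z`, the number of open pairs at `u` forces `t` and `z`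
to be neighbours of `u` in `H`, and the other neighbours of `u` to form a clique. -/
theorem clique_of_thin (S : CommonCard d G H σ v u t) {z : V} (htz : d t z = 1) (hzu : z ≠ u)
    (ht : ∀ k, d k t = 1 → k = u ∨ k = z) :
    H.Adj u t ∧ H.Adj u z ∧ ∀ a b, H.Adj u a → H.Adj u b → ¬ (d a u = 1 ∧ a ≠ t) →
      ¬ (d b u = 1 ∧ b ≠ t) → a ≠ b → H.Adj a b := by
  classical
  have hd := S.tree
  have hc := hd.comm
  have hut := S.outer.adj_ut
  have htu := hc t u
  have hzt := hc z t
  have htz' : t ≠ z := hd.ne_of_pos (by omega)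
  have hzu2 : d z u = 2 := by
    have h1 := hd.adj z u t hut
    have := hd.pos hzu
    omega
  have htu' : t ≠ u := hd.ne_of_pos (by omega)
  -- Besides the leaves `C`, the neighbours of `u` form `N` in `G` and `Y` in `H`; equal degrees
  -- give `Y` and `N` the same size.
  let C : Finset V := Finset.univ.filter fun x => d x u = 1 ∧ x ≠ t
  let N : Finset V := Finset.univ.filter fun x => d x z ≤ 1
  let Y : Finset V := Finset.univ.filter fun x => H.Adj u x ∧ ¬ (d x u = 1 ∧ x ≠ t)
  have hC : ∀ x, x ∈ C ↔ d x u = 1 ∧ x ≠ t := by simp [C]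
  have hN : ∀ x, x ∈ N ↔ d x z ≤ 1 := by simp [N]
  have hY : ∀ x, x ∈ Y ↔ H.Adj u x ∧ ¬ (d x u = 1 ∧ x ≠ t) := by simp [Y]
  have htN : t ∈ N := by simp [hN, htz]
  have hzN : z ∈ N := by simp [hN, hd.self]
  have hNu : ∀ x, x ∈ N → x ≠ u ∧ ¬ (d x u = 1 ∧ x ≠ t) := by
    intro x hx
    rw [hN] at hx
    have h1 := hd.triangle u x z
    have := hc u x
    have := hc u z
    refine ⟨?_, ?_⟩
    · rintro rfl
      omega
    · rintro ⟨h2, h3⟩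
      have := hd.outer_le_three S.outer h2 h3 z
      have h4 := hd.leaf_dist (S.outer.leaf x h2 h3) (k := z) (by rintro rfl; omega)
      have := hc z x
      omega
  have hGN : ∀ x, G.Adj u x ↔ x ∈ C ∨ x ∈ N := by
    intro x
    rw [S.adj, hC, hN, hc u x]
    by_cases hxu : x = u
    · subst hxu
      simp only [ne_eq, not_true, false_and, hd.self, false_iff]
      have := hc x z
      omega
    by_cases hxc : d x u = 1 ∧ x ≠ t
    · simp only [hxc, Ne.symm hxu, ne_eq, not_false_iff, true_and, true_or, iff_true]
      omega
    · rw [hd.thin_center S.outer htz ht hxu hxc]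
      simp [hxc, Ne.symm hxu]
  have hdegG : deg G u = C.card + N.card := by
    rw [← Finset.card_union_of_disjoint, deg_eq_card]
    · congr 1
      ext x
      simp [hGN]
    · rw [Finset.disjoint_left]
      intro x hx hx'
      exact (hNu x hx').2 ((hC x).1 hx)
  have hdegH : deg H u = C.card + Y.card := by
    rw [← Finset.card_union_of_disjoint, deg_eq_card]
    · congr 1
      ext x
      simp only [Finset.mem_filter, Finset.mem_univ, true_and, Finset.mem_union, hC, hY]
      have := S.adj_cls (x := x)
      tauto
    · rw [Finset.disjoint_left]
      intro x hx hx'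
      exact ((hY x).1 hx').2 ((hC x).1 hx)
  have hYN : Y.card = N.card := by
    have := S.deg_eq u
    rw [S.fixed, hdegG, hdegH] at this
    omega
  let N' := N \ {t, z}
  let Y' := Y \ {t, z}
  have hN' : N'.card + 2 = N.card := by
    have h1 : ({t, z} : Finset V) ⊆ N := by
      intro x hx
      simp only [Finset.mem_insert, Finset.mem_singleton] at hx
      rcases hx with rfl | rfl <;> assumption
    have := Finset.card_sdiff_add_card_eq_card h1
    rwa [Finset.card_pair htz'] at this
  have hfarG : ∀ x k, x ∈ C → k ∈ N → k ∉ N' → d x k ≤ 3 := by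
    intro x k hx hk hk'
    rw [hC] at hx
    rw [hc, hd.outer_le_three S.outer hx.1 hx.2]
    have : k = t ∨ k = z := by
      simp only [N', Finset.mem_sdiff, Finset.mem_insert, Finset.mem_singleton, not_and,
        not_not] at hk'
      exact hk' hk
    rcases this with rfl | rfl <;> omega
  -- In `G`, an open pair at `u` consists of a leaf in `C` and a vertex of `N` other than `t` and
  -- `z`.
  have hopenG : openPairs G u ≤ 2 * (C.card * N'.card) := by
    have hcard : 2 * (C.card * N'.card) = (C ×ˢ N').card + (N' ×ˢ C).card := by
      rw [Finset.card_product, Finset.card_product]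
      ring
    rw [hcard]
    refine le_trans (le_trans (le_of_eq ?_) (Finset.card_le_card (s := Finset.univ.filter
      fun p : V × V => (G.Adj u p.1 ∧ G.Adj u p.2) ∧ p.1 ≠ p.2 ∧ ¬ G.Adj p.1 p.2)
      (t := C ×ˢ N' ∪ N' ×ˢ C) ?_)) (Finset.card_union_le _ _)
    · unfold openPairs
      congr
    · rintro ⟨a, b⟩ hab
      simp only [Finset.mem_filter, Finset.mem_univ, true_and, hGN, S.adj, not_and] at hab
      obtain ⟨⟨ha, hb⟩, hab, hab3⟩ := hab
      have hab3 := hab3 hab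
      simp only [Finset.mem_union, Finset.mem_product]
      rcases ha with ha | ha <;> rcases hb with hb | hb
      · exfalso
        rw [hC] at ha hb
        have := hd.triangle a u b
        have := hc u b
        omega
      · left
        refine ⟨ha, ?_⟩
        by_contra h
        exact hab3 (hfarG a b ha hb h)
      · right
        refine ⟨?_, hb⟩
        by_contra h
        exact hab3 (by rw [hc]; exact hfarG b a hb ha h)
      · exfalso
        rw [hN] at ha hb
        have := hd.triangle a z b
        have := hc z b
        omega
  have hdisj : Disjoint (C ×ˢ Y') (Y' ×ˢ C) := by
    rw [Finset.disjoint_left]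
    rintro ⟨a, b⟩ hab hab'
    rw [Finset.mem_product] at hab hab'
    have h1 := hab'.1
    simp only [Y', Finset.mem_sdiff, hY] at h1
    exact h1.1.2 ((hC _).1 hab.1)
  -- In `H`, all of `C × Y'` are open pairs, so `Y'` is no larger than `N'`. Since `N` contains `t`
  -- and `z`, so must `Y`. The bounds are then sharp, and no open pair is left inside `Y`.
  have hfarH : ∀ x k, x ∈ C → k ∈ Y' → H.Adj u x ∧ H.Adj u k ∧ x ≠ k ∧ ¬ H.Adj x k := by
    intro x k hx hk
    simp only [Y', Finset.mem_sdiff, hY, Finset.mem_insert, Finset.mem_singleton, not_or] at hk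
    rw [hC] at hx
    obtain ⟨⟨h1, h2⟩, hkt, hkz⟩ := hk
    have hku : k ≠ u := h1.ne'
    have hxu : x ≠ u := hd.ne_of_pos (by omega)
    have hxk : x ≠ k := by
      rintro rfl
      exact h2 hx
    refine ⟨S.adj_cls hx.1 hx.2, h1, hxk, fun h => ?_⟩
    have h3 := S.le_of_adj hxu hku h
    rw [hc, hd.outer_le_three S.outer hx.1 hx.2] at h3
    have h4 := hd.thin_dist S.outer ht hku h2 hkt
    have := hd.pos hkz
    omega
  let O : Finset (V × V) := Finset.univ.filter fun p : V × V =>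
    (H.Adj u p.1 ∧ H.Adj u p.2) ∧ p.1 ≠ p.2 ∧ ¬ H.Adj p.1 p.2
  have hO : ∀ a b, (a, b) ∈ O ↔ (H.Adj u a ∧ H.Adj u b) ∧ a ≠ b ∧ ¬ H.Adj a b := by simp [O]
  have hOcard : O.card = openPairs H u := by
    unfold openPairs
    congr
  have hsub : C ×ˢ Y' ∪ Y' ×ˢ C ⊆ O := by
    rintro ⟨a, b⟩ hab
    rw [hO]
    rw [Finset.mem_union, Finset.mem_product, Finset.mem_product] at hab
    rcases hab with hab | hab
    · have := hfarH a b hab.1 hab.2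
      tauto
    · have := hfarH b a hab.2 hab.1
      rw [H.adj_comm a b]
      exact ⟨⟨this.2.1, this.1⟩, this.2.2.1.symm, this.2.2.2⟩
  have hUcard : (C ×ˢ Y' ∪ Y' ×ˢ C).card = 2 * (C.card * Y'.card) := by
    rw [Finset.card_union_of_disjoint hdisj, Finset.card_product, Finset.card_product]
    ring
  have hle := Finset.card_le_card hsub
  rw [hUcard, hOcard, S.openPairs_eq, S.fixed] at hle
  have hCpos : 0 < C.card := Finset.card_pos.2 ⟨v, (hC v).2 ⟨S.outer.adj_vu, S.outer.ne⟩⟩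
  have hY'N' : Y'.card ≤ N'.card := by
    have : C.card * Y'.card ≤ C.card * N'.card := by omega
    exact Nat.le_of_mul_le_mul_left this hCpos
  have hY'int : Y'.card + (Y ∩ {t, z}).card = Y.card := by
    rw [add_comm]
    exact Finset.card_inter_add_card_sdiff Y {t, z}
  have hint : Y ∩ {t, z} = {t, z} := by
    refine Finset.eq_of_subset_of_card_le Finset.inter_subset_right ?_
    rw [Finset.card_pair htz']
    omega
  have hsubY : ({t, z} : Finset V) ⊆ Y := Finset.inter_eq_right.1 hint
  rw [hint, Finset.card_pair htz'] at hY'int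
  have hYcard : Y'.card = N'.card := by omega
  have hOeq : C ×ˢ Y' ∪ Y' ×ˢ C = O := by
    refine Finset.eq_of_subset_of_card_le hsub ?_
    rw [hUcard, hOcard, S.openPairs_eq, S.fixed, hYcard]
    exact hopenG
  refine ⟨((hY t).1 (hsubY (by simp))).1, ((hY z).1 (hsubY (by simp))).1, ?_⟩
  intro a b ha hb hac hbc hab
  by_contra h
  have := (hO a b).2 ⟨⟨ha, hb⟩, hab, h⟩
  rw [← hOeq, Finset.mem_union, Finset.mem_product, Finset.mem_product] at this
  rcases this with h | h
  · exact hac ((hC a).1 h.1)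
  · exact hbc ((hC b).1 h.2)

end CommonCard

/-! ### Two trees whose cubes agree off `u` -/

open Classical in
/-- The size of the closed neighbourhood of `x` in the cube. -/
noncomputable def cubeBall {V : Type*} [Fintype V] (d : V → V → ℕ) (x : V) : ℕ :=
  (Finset.univ.filter fun y => d y x ≤ 3).card

theorem cubeBall_le_cubeBall {V : Type*} [Fintype V] {d e : V → V → ℕ} {x y : V}
    (h : ∀ k, d k x ≤ 3 → e k y ≤ 3) : cubeBall d x ≤ cubeBall e y :=
  Finset.card_le_card fun k => by simpa using h k

theorem cubeBall_lt_cubeBall {V : Type*} [Fintype V] {d e : V → V → ℕ} {x y : V}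
    (h : ∀ k, d k x ≤ 3 → e k y ≤ 3) {g : V} (hg : ¬ d g x ≤ 3) (hg' : e g y ≤ 3) :
    cubeBall d x < cubeBall e y :=
  Finset.card_lt_card ((Finset.ssubset_iff_of_subset fun k => by simpa using h k).2
    ⟨g, by simpa using hg', by simpa using hg⟩)

theorem le_three_of_cubeBall_le {V : Type*} [Fintype V] {d e : V → V → ℕ} {x y : V}
    (h : ∀ k, d k x ≤ 3 → e k y ≤ 3) (hle : cubeBall e y ≤ cubeBall d x) (k : V)
    (hk : e k y ≤ 3) : d k x ≤ 3 := by
  by_contra hc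
  have := cubeBall_lt_cubeBall h hc hk
  omega

/-- Two trees whose cubes agree off `u`, where `u` is the center of an outer star of the first tree
and is adjacent, in the cube of the second one, to everything near it. -/
structure TwoTrees {V : Type*} [Fintype V] (d e : V → V → ℕ) (v u t : V) : Prop where
  fst : IsTreeDist d
  snd : IsTreeDist e
  outer : IsOuterLeaf d v u t
  agree : ∀ x y, x ≠ u → y ≠ u → (d x y ≤ 3 ↔ e x y ≤ 3)
  star : ∀ k, d k u ≤ 2 → e k u ≤ 3
  tail : ∃ q, 4 ≤ d v q ∧ d t q = 2
  count : cubeBall e u ≤ cubeBall d u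

namespace TwoTrees

variable {V : Type*} [Fintype V] {d e : V → V → ℕ} {v u t u' t' f : V}

/-- The vertex `v` has the same cube neighbourhood in both trees: off `u` by `agree`, at `u` by
`star`. -/
theorem near_leaf (S : TwoTrees d e v u t) (y : V) : e y v ≤ 3 ↔ d y u ≤ 2 := by
  by_cases hy : y = u
  · subst hy
    have := S.star v (by rw [S.outer.adj_vu]; omega)
    rw [S.snd.comm] at this
    simp [S.fst.self, this]
  · rw [← S.agree y v hy (S.fst.ne_of_pos (by rw [S.outer.adj_vu]; omega)),
      S.fst.outer_le_three S.outer S.outer.adj_vu S.outer.ne]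

theorem near_clique (S : TwoTrees d e v u t) {x y : V} (hx : d x u ≤ 2) (hy : d y u ≤ 2) :
    e x y ≤ 3 := by
  by_cases hxu : x = u
  · subst hxu
    rw [S.snd.comm]
    exact S.star y hy
  by_cases hyu : y = u
  · subst hyu
    exact S.star x hx
  rw [← S.agree x y hxu hyu]
  have key := fun y => S.fst.outer_le_three S.outer S.outer.adj_vu S.outer.ne y
  refine S.fst.outer_simplicial S.outer ?_ ?_
  · rw [S.fst.comm, key]
    exact hx
  · rw [S.fst.comm, key]
    exact hy

/-- In the second cube `v` is still simplicial, and by `tail` not dominating. So it is an outer leaf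
of the second tree too, but possibly with another centre `u'`. -/
theorem exists_outer (S : TwoTrees d e v u t) :
    ∃ u' t' f, IsOuterLeaf e v u' t' ∧ e v f = 4 ∧ e u' f = 3 ∧ e t' f = 2 := by
  obtain ⟨q, hvq, htq⟩ := S.tail
  refine S.snd.exists_outer_of_simplicial (f := q) ?_ fun x y hx hy => ?_
  · by_contra hc
    have h1 := (S.near_leaf q).1 (by rw [S.snd.comm]; omega)
    have h2 := S.fst.outer_le_three S.outer S.outer.adj_vu S.outer.ne q
    have := S.fst.comm q v
    omega
  · rw [S.snd.comm, S.near_leaf] at hx hy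
    exact S.near_clique hx hy

theorem twin_iff (S : TwoTrees d e v u t) (h : IsOuterLeaf e v u' t') (y : V) :
    e y u' ≤ 2 ↔ d y u ≤ 2 := by
  rw [← S.near_leaf, S.snd.outer_le_three h h.adj_vu h.ne]

/-- Vertices near `u` that are not twins of `v` are near `t'`. -/
theorem near_tail_of_not_twin (S : TwoTrees d e v u t) (h : IsOuterLeaf e v u' t') {k y : V}
    (hk : d k u ≤ 2) (hky : e y k ≤ 3) (hy : ¬ d y u ≤ 2) : e k t' ≤ 1 := by
  rw [← S.twin_iff h] at hk hy
  by_cases hku : k = u'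
  · subst hku
    rw [h.adj_ut]
  · refine S.snd.outer_le_one h hk hku fun hc => hy ?_
    rwa [S.snd.outer_le_three h hc.1 hc.2] at hky

/-- Such a `k` sees the vertex `q` of `tail`, which `v` does not see; hence `k` is no leaf at `u'`.
-/
theorem near_tail (S : TwoTrees d e v u t) (h : IsOuterLeaf e v u' t') {k : V} (hku : k ≠ u)
    (hk : d k t ≤ 1) : e k t' ≤ 1 := by
  have hut := S.outer.adj_ut
  have hc := S.fst.comm
  obtain ⟨q, hvq, htq⟩ := S.tail
  have h2 := S.fst.outer_le_three S.outer S.outer.adj_vu S.outer.ne q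
  have hqu : q ≠ u := by
    rintro rfl
    have := hc t q
    omega
  have h3 := S.fst.triangle k t u
  have h4 := S.fst.triangle q t k
  have := hc t u
  have := hc t k
  have := hc t q
  have := hc q v
  refine S.near_tail_of_not_twin h (k := k) (y := q) (by omega) ?_ (by omega)
  rw [← S.agree q k hqu hku]
  omega

/-- A partial converse of `near_tail`: `v` does not see `f`, hence no leaf at `u` does, while `k`
sees it. -/
theorem center_cases (S : TwoTrees d e v u t) (h : IsOuterLeaf e v u' t') (hf : e v f = 4)
    {k : V} (hk : e k t' ≤ 1) (hkf : e k f ≤ 3) :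
    k = u ∨ d k t ≤ 1 ∧ k ≠ u := by
  by_cases hku : k = u
  · exact Or.inl hku
  have h1 : d k u ≤ 2 := by
    rw [← S.twin_iff h]
    have := S.snd.triangle k t' u'
    have := S.snd.comm t' u'
    have := h.adj_ut
    omega
  refine Or.inr ⟨S.fst.outer_le_one S.outer h1 hku fun hc => ?_, hku⟩
  have hfu : ¬ d f u ≤ 2 := by
    rw [← S.near_leaf, S.snd.comm]
    omega
  have hfu' : f ≠ u := by
    rintro rfl
    rw [S.fst.self] at hfu
    omega
  rw [S.snd.comm, ← S.agree f k hfu' hku, S.fst.outer_le_three S.outer hc.1 hc.2] at hkf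
  exact hfu hkf

/-- Closed neighbourhoods of `u` and of the neighbours of `t` in the second cube. -/
theorem ball_subset (S : TwoTrees d e v u t) {k y : V} (hku : k ≠ u) (hk : d k t ≤ 1)
    (hy : e y u ≤ 3) : e y k ≤ 3 := by
  obtain ⟨u', t', f, h, hvf, huf, htf⟩ := S.exists_outer
  have hu't' := h.adj_ut
  have hc := S.snd.comm
  have hkt := S.near_tail h hku hk
  have hkd : d k u ≤ 2 := by
    have := S.fst.triangle k t u
    have := S.fst.comm t u
    have := S.outer.adj_ut
    omega
  have huu : e u u' ≤ 2 := by
    rw [S.twin_iff h, S.fst.self]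
    omega
  have hfin : e y u' ≤ 3 → e y k ≤ 3 := by
    intro hyu
    rw [S.snd.outer_center_le_three h] at hyu
    have := S.snd.triangle y t' k
    have := hc t' k
    omega
  -- In the second tree `u` is a leaf at `u'`, or equal to `u'`, or within distance 1 of `t'`. In
  -- the last case the cube neighbourhood of `u'` lies in that of `u`, and `count` makes them equal,
  -- since `u'` sees everything that `u` sees in the first cube.
  by_cases hcase : e u u' = 1 ∧ u ≠ t'
  · rw [S.snd.outer_le_three h hcase.1 hcase.2, S.twin_iff h] at hy
    exact S.near_clique hy hkd
  rcases S.center_cases h hvf (k := u') (by omega) (by omega) with rfl | ⟨hu'1, hu'2⟩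
  · exact hfin hy
  have hut' := S.snd.outer_le_one h huu (Ne.symm hu'2) hcase
  refine hfin (le_three_of_cubeBall_le (d := e) (e := e) (x := u') (y := u)
    (fun y hy => ?_) ?_ y hy)
  · rw [S.snd.outer_center_le_three h] at hy
    have := S.snd.triangle y t' u
    have := hc t' u
    omega
  · refine S.count.trans (cubeBall_le_cubeBall fun y hy => ?_)
    by_cases hyu : y = u
    · rw [hyu]
      omega
    rw [← S.agree y u' hyu hu'2]
    rw [S.fst.outer_center_le_three S.outer] at hy
    have := S.fst.triangle y t u'
    have := S.fst.comm t u'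
    omega

/-- By `ball_subset`, `x` is within 3 of both `k₁` and `k₂`, and one of them is farther from `x`
than `t`. -/
theorem le_three_of_thick (S : TwoTrees d e v u t) {k₁ k₂ : V} (hk : k₁ ≠ k₂) (h₁ : d t k₁ = 1)
    (h₂ : d t k₂ = 1) (hu₁ : k₁ ≠ u) (hu₂ : k₂ ≠ u) {x : V} (hx : e x u ≤ 3) : d x t ≤ 2 := by
  by_cases hxu : x = u
  · rw [hxu, S.outer.adj_ut]
    omega
  have e₁ := S.ball_subset hu₁ (by rw [S.fst.comm]; omega) hx
  have e₂ := S.ball_subset hu₂ (by rw [S.fst.comm]; omega) hx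
  rw [← S.agree _ _ hxu hu₁] at e₁
  rw [← S.agree _ _ hxu hu₂] at e₂
  have := S.fst.far_of_ne x h₁ h₂ hk
  omega

/-- The centre `u'`, its tail `t'` and the next vertex `z'` are distinct members of `{u, t, z}`.
Cube balls grow weakly in size along `u', t', z'` and strictly along `u, t, z`, so the triples
coincide and `thin_agree_or_swap` applies. The vertex `g` makes the growth from `t` to `z` strict.
-/
theorem agree_or_swap_of_thin (S : TwoTrees d e v u t) {z g : V} (htz : d t z = 1) (hzu : z ≠ u)
    (ht : ∀ k, d k t = 1 → k = u ∨ k = z) (hcount : cubeBall e u = cubeBall d u)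
    (hgz : d g z = 3) (hgt : d g t = 4) :
    (∀ x, d x u ≤ 3 ↔ e x u ≤ 3) ∨
      ∃ y y₁, y ≠ y₁ ∧ y ≠ u ∧ y₁ ≠ u ∧ d y u ≤ 3 ∧ ¬ d y₁ u ≤ 3 ∧ ¬ e y u ≤ 3 ∧ e y₁ u ≤ 3 ∧
        (∀ x, x ≠ y → x ≠ y₁ → (d x u ≤ 3 ↔ e x u ≤ 3)) ∧
        ∀ x, x ≠ u → (d x y ≤ 3 ↔ d x y₁ ≤ 3) := by
  have hd := S.fst
  have he := S.snd
  have hdc := hd.comm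
  have hec := he.comm
  have hut := S.outer.adj_ut
  have htu := hdc t u
  have hzt := hdc z t
  have htu' : t ≠ u := hd.ne_of_pos (by omega)
  have hzt' : z ≠ t := hd.ne_of_pos (by omega)
  have hzu2 : d z u = 2 := by
    have h1 := hd.adj z u t hut
    have := hd.pos hzu
    omega
  obtain ⟨u', t', f, h, hvf, huf, htf⟩ := S.exists_outer
  have hut' := h.adj_ut
  obtain ⟨z', hz', hfz'⟩ := he.closer f t' (he.ne_of_pos (by omega))
  have hft' := hec f t'
  have hfz := hec f z'
  have hz't' := hec z' t'
  have hu'z' : u' ≠ z' := by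
    rintro rfl
    omega
  have hu't' : u' ≠ t' := he.ne_of_pos (by omega)
  have hz't'' : z' ≠ t' := he.ne_of_pos (by omega)
  have hcover : ∀ k, e k t' ≤ 1 → k = u ∨ k = t ∨ k = z := by
    intro k hk
    have := he.triangle k t' f
    rcases S.center_cases h hvf hk (by omega) with h1 | ⟨h1, h2⟩
    · exact Or.inl h1
    · rcases Nat.lt_or_ge 0 (d k t) with h3 | h3
      · rcases ht k (by omega) with h4 | h4
        · exact absurd h4 h2
        · exact Or.inr (Or.inr h4)
      · exact Or.inr (Or.inl ((hd.eq_zero _ _).1 (by omega)))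
  have hu'cov := hcover u' (by omega)
  have ht'cov := hcover t' (by rw [he.self]; omega)
  have hz'cov := hcover z' (by omega)
  have hnbr : ∀ k, e k t' = 1 → k = u' ∨ k = z' := by
    intro k hk
    have hkt' : k ≠ t' := he.ne_of_pos (by omega)
    have := hcover k (by omega)
    grind
  have hle₁ : cubeBall e u' ≤ cubeBall e t' := cubeBall_le_cubeBall fun y hy => by
    rw [he.outer_center_le_three h] at hy
    omega
  have hle₂ : cubeBall e t' ≤ cubeBall e z' := cubeBall_le_cubeBall fun y hy => by
    by_cases hyu : y = u'
    · subst hyu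
      have := he.triangle y t' z'
      omega
    by_cases hyc : e y u' = 1 ∧ y ≠ t'
    · have := he.triangle y u' z'
      have := he.triangle u' t' z'
      omega
    by_cases hyt : y = t'
    · subst hyt
      omega
    have := he.thin_dist h hnbr hyu hyc hyt
    omega
  have hball : ∀ x, x ≠ u → d x u ≤ 2 → cubeBall e x = cubeBall d x := by
    intro x hxu hx
    have key : ∀ y, e y x ≤ 3 ↔ d y x ≤ 3 := by
      intro y
      by_cases hyu : y = u
      · subst hyu
        have := S.star x hx
        have := hdc x y
        have := hec x y
        omega
      · exact (S.agree y x hyu hxu).symm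
    exact le_antisymm (cubeBall_le_cubeBall fun y => (key y).1)
      (cubeBall_le_cubeBall fun y => (key y).2)
  obtain ⟨g', hg', hgg'⟩ := hd.exists_on_path t g 1 (by rw [hdc]; omega)
  have hlt₁ : cubeBall e u < cubeBall e t := by
    rw [hcount, hball t htu' (by omega)]
    refine cubeBall_lt_cubeBall (g := g') (fun y hy => ?_) ?_ ?_
    · rw [hd.outer_center_le_three S.outer] at hy
      omega
    · rw [hd.outer_center_le_three S.outer, hdc]
      have := hdc t g
      omega
    · rw [hdc]
      have := hdc t g
      omega
  have hlt₂ : cubeBall e t < cubeBall e z := by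
    rw [hball t htu' (by omega), hball z hzu (by omega)]
    refine cubeBall_lt_cubeBall (g := g) (fun y hy => ?_) (by omega) (by omega)
    by_cases hyu : y = u
    · subst hyu
      have := hdc y z
      omega
    by_cases hyc : d y u = 1 ∧ y ≠ t
    · have := hd.triangle y u z
      have := hdc u z
      omega
    by_cases hyt : y = t
    · subst hyt
      omega
    have := hd.thin_dist S.outer ht hyu hyc hyt
    omega
  have hu'e : u' = u := by
    rcases hu'cov with h1 | h1 | h1
    · exact h1
    · rw [h1] at hle₁ hu'z' hu't'
      rcases ht'cov with h2 | h2 | h2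
      · rw [h2] at hle₁
        omega
      · exact absurd h2.symm hu't'
      · rw [h2] at hle₂ hz't''
        rcases hz'cov with h3 | h3 | h3
        · rw [h3] at hle₂
          omega
        · exact absurd h3.symm hu'z'
        · exact absurd h3 hz't''
    · rw [h1] at hle₁ hu't'
      rcases ht'cov with h2 | h2 | h2
      · rw [h2] at hle₁
        omega
      · rw [h2] at hle₁
        omega
      · exact absurd h2.symm hu't'
  subst hu'e
  have ht'e : t' = t := by
    rcases ht'cov with h2 | h2 | h2
    · exact absurd h2.symm hu't'
    · exact h2
    · rw [h2] at hle₂ hz't''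
      rcases hz'cov with h3 | h3 | h3
      · exact absurd h3.symm hu'z'
      · rw [h3] at hle₂
        omega
      · exact absurd h3 hz't''
  subst ht'e
  have hz'e : z' = z := by
    rcases hz'cov with h3 | h3 | h3
    · exact absurd h3.symm hu'z'
    · exact absurd h3 hz't''
    · exact h3
  subst hz'e
  have hzu2' : e z' u' = 2 := by
    have h1 := he.adj z' u' t' hut'
    have := he.pos hzu
    omega
  refine hd.thin_agree_or_swap he S.outer h (fun x hxt => ⟨fun hx => ?_, fun hx => ?_⟩) htz hz'
    hzu ht hnbr S.agree (q := g) (by omega) ?_ ?_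
  · have hxu : x ≠ u' := hd.ne_of_pos (by omega)
    have h1 : e x u' ≤ 2 := by
      rw [S.twin_iff h]
      omega
    by_contra hx1
    have h2 := he.outer_le_one h h1 hxu (by omega)
    rcases hcover x h2 with h3 | h3 | h3
    · exact hxu h3
    · exact hxt h3
    · rw [h3] at hx
      omega
  · have hxu : x ≠ u' := he.ne_of_pos (by omega)
    have h1 : d x u' ≤ 2 := by
      rw [← S.twin_iff h]
      omega
    by_contra hx1
    have h2 := hd.outer_le_one S.outer h1 hxu (by omega)
    have h3 := hd.pos hxt
    rcases ht x (by omega) with h4 | h4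
    · exact hxu h4
    · rw [h4] at hx
      omega
  · rintro rfl
    omega
  · rintro ⟨h1, h2⟩
    have := hd.triangle g u' t'
    omega

end TwoTrees

/-! ### Moving one edge at `u` -/

theorem eq_of_adj_iff {V : Type*} {G H : SimpleGraph V} {u : V}
    (hag : ∀ x y, x ≠ u → y ≠ u → (H.Adj x y ↔ G.Adj x y)) (hu : ∀ x, H.Adj u x ↔ G.Adj u x) :
    H = G := by
  ext x y
  by_cases hx : x = u
  · rw [hx, hu]
  by_cases hy : y = u
  · rw [hy, H.adj_comm, G.adj_comm, hu]
  exact hag x y hx hy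

/-- If `H` arises from `G` by moving the edge `uy` to `uy₁`, where `y` and `y₁` are twins away from
`u` and possibly `w`, and the degree sequences agree, then `y` and `y₁` may be swapped. -/
theorem iso_of_moved_edge {V : Type*} [Fintype V] {G H : SimpleGraph V} {u w y y₁ : V}
    (hag : ∀ a b, a ≠ u → b ≠ u → (H.Adj a b ↔ G.Adj a b)) (hne : y ≠ y₁) (hyu : y ≠ u)
    (hy₁u : y₁ ≠ u) (hwu : w ≠ u) (hwy : w ≠ y) (hwy₁ : w ≠ y₁) (h1 : G.Adj u y)
    (h2 : ¬ G.Adj u y₁) (h3 : ¬ H.Adj u y) (h4 : H.Adj u y₁)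
    (h5 : ∀ x, x ≠ y → x ≠ y₁ → (G.Adj u x ↔ H.Adj u x))
    (h6 : ∀ x, x ≠ u → x ≠ w → x ≠ y → x ≠ y₁ → (G.Adj x y ↔ G.Adj x y₁))
    (σ : V ≃ V) (hdeg : ∀ x, deg H x = deg G (σ x)) (hu : deg H u = deg G u) :
    Nonempty (H ≃g G) := by
  classical
  have hyy : adjInd G y₁ y = adjInd G y y₁ := adjInd_comm _ _ _
  have e1 : adjInd G y u = 1 := by simp [adjInd, h1.symm]
  have e2 : adjInd G y₁ u = 0 := by simp [adjInd, G.adj_comm y₁ u, h2]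
  have e3 : adjInd H y u = 0 := by simp [adjInd, H.adj_comm y u, h3]
  have e4 : adjInd H y₁ u = 1 := by simp [adjInd, h4.symm]
  -- Only `y` loses and only `y₁` gains a degree, so equal sums of squares say that in `G` the
  -- degree of `y` exceeds that of `y₁` by exactly one.
  have hsq : ∑ x, (deg H x : ℤ) ^ 2 = ∑ x, (deg G x : ℤ) ^ 2 := by
    simp_rw [hdeg]
    exact σ.sum_comp fun x => (deg G x : ℤ) ^ 2
  have hdy : (deg H y : ℤ) = deg G y - 1 := by
    rw [deg_eq_sum, deg_eq_sum, eq_sub_iff_add_eq]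
    have : ∀ x, adjInd G y x = adjInd H y x + if x = u then 1 else 0 := by
      intro x
      by_cases hx : x = u
      · simp [hx, e1, e3]
      · simp [hx, adjInd_congr (hag y x hyu hx)]
    simp_rw [this, Finset.sum_add_distrib]
    simp
  have hdy₁ : (deg H y₁ : ℤ) = deg G y₁ + 1 := by
    rw [deg_eq_sum, deg_eq_sum]
    have : ∀ x, adjInd H y₁ x = adjInd G y₁ x + if x = u then 1 else 0 := by
      intro x
      by_cases hx : x = u
      · simp [hx, e2, e4]
      · simp [hx, adjInd_congr (hag y₁ x hy₁u hx)]
    simp_rw [this, Finset.sum_add_distrib]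
    simp
  have hother : ∀ x, x ≠ y → x ≠ y₁ → deg H x = deg G x := by
    intro x hx hx'
    by_cases hxu : x = u
    · rw [hxu, hu]
    rw [deg_eq_card, deg_eq_card]
    congr 1
    ext a
    by_cases ha : a = u
    · subst ha
      simp [H.adj_comm x a, G.adj_comm x a, h5 x hx hx']
    · simp [hag x a hxu ha]
  have hab : (deg G y : ℤ) = deg G y₁ + 1 := by
    have hx : ∀ x, (deg H x : ℤ) ^ 2 = (deg G x : ℤ) ^ 2 +
        (if x = y then 1 - 2 * (deg G y : ℤ) else 0) +
        (if x = y₁ then 2 * (deg G y₁ : ℤ) + 1 else 0) := by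
      intro x
      by_cases hxy : x = y
      · subst hxy
        rw [hdy]
        simp only [if_true, hne, if_false]
        ring
      · by_cases hxy₁ : x = y₁
        · subst hxy₁
          rw [hdy₁]
          simp only [if_true, hxy, if_false]
          ring
        · simp [hxy, hxy₁, hother x hxy hxy₁]
    simp_rw [hx, Finset.sum_add_distrib] at hsq
    simp only [Finset.sum_ite_eq', Finset.mem_univ, if_true] at hsq
    omega
  -- The edge `uy` already accounts for this difference, so `w` cannot distinguish `y` from `y₁`.
  have hw : G.Adj w y ↔ G.Adj w y₁ := by
    have hx : ∀ x, adjInd G y x = adjInd G y₁ x + (if x = u then 1 else 0) +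
        (if x = w then adjInd G y w - adjInd G y₁ w else 0) +
        (if x = y₁ then adjInd G y y₁ else 0) - (if x = y then adjInd G y y₁ else 0) := by
      intro x
      by_cases hxu : x = u
      · subst hxu
        simp [hwu.symm, hyu.symm, hy₁u.symm, e1, e2]
      by_cases hxw : x = w
      · subst hxw
        simp [hwu, hwy, hwy₁]
      by_cases hxy : x = y
      · subst hxy
        simp [hyu, hwy.symm, hne, adjInd_self, hyy]
      by_cases hxy₁ : x = y₁
      · subst hxy₁
        simp [hxu, hxw, hxy, adjInd_self]
      · have := h6 x hxu hxw hxy hxy₁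
        rw [G.adj_comm x y, G.adj_comm x y₁] at this
        simp [hxu, hxw, hxy, hxy₁, adjInd_congr this]
    rw [deg_eq_sum, deg_eq_sum, Finset.sum_congr rfl fun x _ => hx x] at hab
    simp only [Finset.sum_sub_distrib, Finset.sum_add_distrib, Finset.sum_ite_eq',
      Finset.mem_univ, if_true] at hab
    have : adjInd G y w = adjInd G y₁ w := by omega
    rw [G.adj_comm w y, G.adj_comm w y₁]
    clear hx hab
    by_cases a : G.Adj y w <;> by_cases b : G.Adj y₁ w <;> simp [adjInd, a, b] at this ⊢
  have htw : ∀ x, x ≠ u → x ≠ y → x ≠ y₁ → (G.Adj x y ↔ G.Adj x y₁) := by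
    intro x hxu
    by_cases hxw : x = w
    · rw [hxw]
      exact fun _ _ => hw
    · exact h6 x hxu hxw
  have hsu : Equiv.swap y y₁ u = u := Equiv.swap_apply_of_ne_of_ne hyu.symm hy₁u.symm
  have hoff : ∀ a b, a ≠ u → b ≠ u →
      (G.Adj (Equiv.swap y y₁ a) (Equiv.swap y y₁ b) ↔ G.Adj a b) := by
    intro a b ha hb
    by_cases hay : a = y
    · subst hay
      by_cases hba : b = a
      · subst hba
        simp
      by_cases hby : b = y₁
      · subst hby
        simp [G.adj_comm]
      rw [Equiv.swap_apply_left, Equiv.swap_apply_of_ne_of_ne hba hby, G.adj_comm, G.adj_comm a,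
        htw b hb hba hby]
    by_cases hay₁ : a = y₁
    · subst hay₁
      by_cases hba : b = a
      · subst hba
        simp
      by_cases hby : b = y
      · subst hby
        simp [G.adj_comm]
      rw [Equiv.swap_apply_right, Equiv.swap_apply_of_ne_of_ne hby hba, G.adj_comm, G.adj_comm a,
        htw b hb hby hba]
    rw [Equiv.swap_apply_of_ne_of_ne hay hay₁]
    by_cases hby : b = y
    · subst hby
      rw [Equiv.swap_apply_left, htw a ha hay hay₁]
    by_cases hby₁ : b = y₁
    · subst hby₁
      rw [Equiv.swap_apply_right, htw a ha hay hay₁]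
    rw [Equiv.swap_apply_of_ne_of_ne hby hby₁]
  have hucase : ∀ b, G.Adj u (Equiv.swap y y₁ b) ↔ H.Adj u b := by
    intro b
    by_cases hby : b = y
    · subst hby
      rw [Equiv.swap_apply_left]
      exact iff_of_false h2 h3
    by_cases hby₁ : b = y₁
    · subst hby₁
      rw [Equiv.swap_apply_right]
      exact iff_of_true h1 h4
    rw [Equiv.swap_apply_of_ne_of_ne hby hby₁, h5 b hby hby₁]
  refine ⟨⟨Equiv.swap y y₁, fun {a b} => ?_⟩⟩
  by_cases ha : a = u
  · subst ha
    rw [hsu, hucase]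
  by_cases hb : b = u
  · subst hb
    rw [hsu, G.adj_comm, hucase, H.adj_comm]
  rw [hoff a b ha hb, hag a b ha hb]

/-- Only an inequality holds in general, because the ball loses `w` when `u` and `w` are adjacent.
-/
theorem cubeBall_subtype {V : Type*} [Fintype V] {d : V → V → ℕ} {K : SimpleGraph V} {u w : V}
    [Fintype {x // x ≠ w}] (hu : u ≠ w) (h : ∀ y, y ≠ w → (d y u ≤ 3 ↔ y = u ∨ K.Adj u y)) :
    cubeBall (fun a b : {x // x ≠ w} => d a.1 b.1) ⟨u, hu⟩ ≤ deg K u + 1 ∧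
      (¬ K.Adj u w →
        cubeBall (fun a b : {x // x ≠ w} => d a.1 b.1) ⟨u, hu⟩ = deg K u + 1) := by
  classical
  have h1 : cubeBall (fun a b : {x // x ≠ w} => d a.1 b.1) ⟨u, hu⟩ =
      (Finset.univ.filter fun y => y ≠ w ∧ (y = u ∨ K.Adj u y)).card := by
    unfold cubeBall
    rw [← Finset.card_map (Function.Embedding.subtype _)]
    congr 1
    ext y
    simp only [Finset.mem_map, Finset.mem_filter, Finset.mem_univ, true_and,
      Function.Embedding.subtype_apply, Subtype.exists, exists_and_right, exists_eq_right]
    constructor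
    · rintro ⟨hy, hy'⟩
      exact ⟨hy, (h y hy).1 hy'⟩
    · rintro ⟨hy, hy'⟩
      exact ⟨hy, (h y hy).2 hy'⟩
  rw [h1, deg_add_one (G := K) (p := fun y => y = u ∨ K.Adj u y) fun y => Iff.rfl]
  refine ⟨Finset.card_le_card fun y => ?_, fun hw => ?_⟩
  · simp only [Finset.mem_filter, Finset.mem_univ, true_and]
    exact And.right
  · congr 1
    ext y
    simp only [Finset.mem_filter, Finset.mem_univ, true_and, and_iff_right_iff_imp]
    rintro hy rfl
    rcases hy with hy | hy
    · exact hu hy.symm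
    · exact hw hy

/-! ### Determining the neighbourhood of `u` -/

namespace CommonCard

variable {V : Type*} [Fintype V] {d : V → V → ℕ} {G H : SimpleGraph V} {σ : V ≃ V} {v u t : V}

theorem exists_far_leaf (S : CommonCard d G H σ v u t) :
    ∃ w p s, IsOuterLeaf d w p s ∧ 4 ≤ d t w := by
  obtain ⟨f, hf⟩ := S.far t
  obtain ⟨w, p, s, h, hw⟩ := S.tree.exists_outer_of_far t (f := f) (by omega)
  exact ⟨w, p, s, h, by omega⟩

theorem far_leaf_dist (S : CommonCard d G H σ v u t) {w : V} (hw : 4 ≤ d t w) :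
    w ≠ u ∧ ¬ (d w u = 1 ∧ w ≠ t) ∧ d w u = d w t + 1 := by
  have hc := S.tree.comm
  have h1 := S.tree.triangle t u w
  have := S.outer.adj_ut
  have := hc t u
  have := hc u w
  have hwu : w ≠ u := by
    rintro rfl
    omega
  have hwc : ¬ (d w u = 1 ∧ w ≠ t) := by omega
  exact ⟨hwu, hwc, S.tree.outer_dist S.outer hwu hwc⟩

/-- As `w` is simplicial in `H`, `σ w` is simplicial in `G` and hence a leaf of the tree. So `H - w`
is the cube of a tree; `e` is `d` pulled back along the isomorphism of cards. The equal degrees of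
`u` in `H` and `G` give `count`. -/
theorem exists_twoTrees (S : CommonCard d G H σ v u t)
    (hstar : ∀ k, k ≠ u → d k u ≤ 2 → H.Adj u k) {w p s : V} (hw : IsOuterLeaf d w p s)
    (htw : 4 ≤ d t w) (hs : openPairs H w = 0)
    (φ : Nonempty (deleteVertex H w ≃g deleteVertex G (σ w))) :
    ∃ e : V → V → ℕ, (∀ x y, x ≠ w → y ≠ w → (H.Adj x y ↔ x ≠ y ∧ e x y ≤ 3)) ∧
      ∃ (_ : Fintype {x // x ≠ w}) (hv : v ≠ w) (hu : u ≠ w) (ht : t ≠ w),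
        TwoTrees (fun a b : {x // x ≠ w} => d a.1 b.1) (fun a b : {x // x ≠ w} => e a.1 b.1)
          ⟨v, hv⟩ ⟨u, hu⟩ ⟨t, ht⟩ ∧
        (¬ H.Adj u w → cubeBall (fun a b : {x // x ≠ w} => e a.1 b.1) ⟨u, hu⟩ =
          cubeBall (fun a b : {x // x ≠ w} => d a.1 b.1) ⟨u, hu⟩) := by
  classical
  have hd := S.tree
  obtain ⟨hwu, hwc, hwd⟩ := S.far_leaf_dist htw
  have hc := hd.comm
  have hut := S.outer.adj_ut
  have hvu := S.outer.adj_vu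
  have hct := hc t w
  obtain ⟨τ, hτw, hτ⟩ := exists_equiv_of_card_iso φ.some
  have hdτ := hd.comp_equiv τ
  obtain ⟨f, hf⟩ := S.far (σ w)
  obtain ⟨a, b, -, hab, -⟩ := hd.exists_outer_of_simplicial hf fun x y hx hy => by
    rw [S.openPairs_eq, openPairs_eq_zero] at hs
    by_cases hxy : x = y
    · rw [hxy, hd.self]
      omega
    by_cases hxw : x = σ w
    · rwa [hxw]
    by_cases hyw : y = σ w
    · rwa [hyw, hc]
    exact ((S.adj _ _).1 (hs x y ((S.adj _ _).2 ⟨Ne.symm hxw, hx⟩)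
      ((S.adj _ _).2 ⟨Ne.symm hyw, hy⟩) hxy)).2
  have hleaf := hab.leaf _ hab.adj_vu hab.ne
  have hleaf' : IsLeafAt (fun x y => d (τ x) (τ y)) w (τ.symm a) := by
    refine ⟨by simpa [hτw] using hleaf.1, fun y hy => ?_⟩
    rw [Equiv.eq_symm_apply]
    exact hleaf.2 _ (by rw [← hτw]; exact hy)
  have hH : ∀ x y, x ≠ w → y ≠ w → (H.Adj x y ↔ x ≠ y ∧ d (τ x) (τ y) ≤ 3) := by
    intro x y hx hy
    rw [hτ x y hx hy, S.adj, τ.injective.ne_iff]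
  have hvw : v ≠ w := by
    rintro rfl
    exact hwc ⟨hvu, S.outer.ne⟩
  have htw' : t ≠ w := hd.ne_of_pos (by omega)
  have hGd : ∀ y, y ≠ w → (d y u ≤ 3 ↔ y = u ∨ G.Adj u y) := by
    intro y _
    rw [S.adj, hc y u]
    by_cases h : y = u
    · simp [h, hd.self]
    · simp [h, Ne.symm h]
  have hHe : ∀ y, y ≠ w → (d (τ y) (τ u) ≤ 3 ↔ y = u ∨ H.Adj u y) := by
    intro y hy
    rw [hH u y hwu.symm hy, hc (τ y)]
    by_cases h : y = u
    · simp [h, hd.self]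
    · simp [h, Ne.symm h]
  have hG1 := (cubeBall_subtype hwu.symm hGd).2 fun h => by
    have := ((S.adj _ _).1 h).2
    rw [hc] at this
    omega
  have hH1 := cubeBall_subtype (d := fun x y => d (τ x) (τ y)) hwu.symm hHe
  have hdeg := S.deg_eq u
  rw [S.fixed] at hdeg
  refine ⟨fun x y => d (τ x) (τ y), hH, inferInstance, hvw, hwu.symm, htw',
    ⟨hd.delete_leaf (hw.leaf w hw.adj_vu hw.ne), hdτ.delete_leaf hleaf', S.outer.restrict _ _ _,
      ?_, ?_, ?_, ?_⟩, ?_⟩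
  · rintro ⟨x, hx⟩ ⟨y, hy⟩ hxu hyu
    simp only [ne_eq, Subtype.mk.injEq] at hxu hyu
    have h1 := S.agree x y hxu hyu
    rw [hH x y hx hy, S.adj] at h1
    by_cases hxy : x = y
    · simp [hxy, hd.self]
    · simpa [hxy] using h1.symm
  · rintro ⟨k, hk⟩ hku
    rw [hHe k hk]
    by_cases h : k = u
    · exact Or.inl h
    · exact Or.inr (hstar k h hku)
  · obtain ⟨q, h1, -, h3⟩ := S.exists_far_tail
    refine ⟨⟨q, ?_⟩, h1.ge, h3⟩
    rintro rfl
    omega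
  · rw [hG1, ← hdeg]
    exact hH1.1
  · intro hn
    rw [hG1, ← hdeg]
    exact hH1.2 hn

theorem simplicial_far_leaf (S : CommonCard d G H σ v u t) {w p s : V} (hw : IsOuterLeaf d w p s) :
    openPairs G w = 0 := by
  rw [openPairs_eq_zero]
  intro a b ha hb hab
  rw [S.adj] at ha hb ⊢
  exact ⟨hab, S.tree.outer_simplicial hw ha.2 hb.2⟩

theorem iso_of_thick (S : CommonCard d G H σ v u t)
    (hcard : ∀ w, Nonempty (deleteVertex H w ≃g deleteVertex G (σ w))) {k₁ k₂ : V} (hk : k₁ ≠ k₂)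
    (h₁ : d t k₁ = 1) (h₂ : d t k₂ = 1) (hu₁ : k₁ ≠ u) (hu₂ : k₂ ≠ u) : Nonempty (H ≃g G) := by
  classical
  have hd := S.tree
  have hc := hd.comm
  have hiff := S.openPairs_iff_of_thick hk h₁ h₂ hu₁ hu₂
  have hvu := S.outer.adj_vu
  have hvu' : v ≠ u := hd.ne_of_pos (by omega)
  have huv := S.adj_cls S.outer.adj_vu S.outer.ne
  have hsv : openPairs H v = 0 := (hiff v).2 (S.openPairs_cls S.outer.adj_vu S.outer.ne)
  -- Since `v` is simplicial in `H` and adjacent to `u`, all its other neighbours are adjacent to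
  -- `u`.
  have hstar : ∀ k, k ≠ u → d k u ≤ 2 → H.Adj u k := by
    intro k hku hk2
    by_cases hkv : k = v
    · rwa [hkv]
    rw [← hd.outer_le_three S.outer S.outer.adj_vu S.outer.ne, hc] at hk2
    exact openPairs_eq_zero.1 hsv u k huv.symm (S.adj_of_le hvu' hku (Ne.symm hkv) hk2)
      (Ne.symm hku)
  obtain ⟨w, p, s, hw, htw⟩ := S.exists_far_leaf
  have hsw : openPairs H w = 0 := (hiff w).2 (S.simplicial_far_leaf hw)
  obtain ⟨e, hH, _, hv, hu, ht, T, -⟩ := S.exists_twoTrees hstar hw htw hsw (hcard w)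
  have hx : ∀ x, x ≠ w → H.Adj u x → d x t ≤ 2 := by
    intro x hxw hux
    have hk₁ : k₁ ≠ w := by
      rintro rfl
      omega
    have hk₂ : k₂ ≠ w := by
      rintro rfl
      omega
    exact T.le_three_of_thick (k₁ := ⟨k₁, hk₁⟩) (k₂ := ⟨k₂, hk₂⟩) (by simpa using hk) h₁ h₂
      (by simpa using hu₁) (by simpa using hu₂) (x := ⟨x, hxw⟩)
      ((hH x u hxw hu).1 hux.symm).2
  obtain ⟨hwu, hwc, hwd⟩ := S.far_leaf_dist htw
  have hct := hc t w
  -- Since `w` is simplicial in `H`, an edge `uw` would make `u` adjacent to the tree neighbour `p`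
  -- of `w`, which is at distance at least 3 from `t`, against `hx`.
  have huw : ¬ H.Adj u w := by
    intro h
    have hwp := hw.adj_vu
    have hpu : p ≠ u := by
      rintro rfl
      omega
    have hpw : w ≠ p := hd.ne_of_pos (by omega)
    have h1 := openPairs_eq_zero.1 hsw u p h.symm
      (S.adj_of_le hwu hpu hpw (by omega)) hpu.symm
    have h2 := hx p hpw.symm h1
    have := hd.triangle w p t
    omega
  have hsub : ∀ x, H.Adj u x → G.Adj u x := by
    intro x hux
    have hxw : x ≠ w := by
      rintro rfl
      exact huw hux
    rw [S.adj, hc, hd.outer_center_le_three S.outer]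
    exact ⟨hux.ne, hx x hxw hux⟩
  have heq : Finset.univ.filter (H.Adj u) = Finset.univ.filter (G.Adj u) := by
    refine Finset.eq_of_subset_of_card_le (fun x => by simpa using hsub x) ?_
    rw [← deg_eq_card, ← deg_eq_card, S.deg_eq, S.fixed]
  have : H = G := eq_of_adj_iff S.agree fun x => by
    simpa using congrArg (x ∈ ·) heq
  rw [this]
  exact ⟨SimpleGraph.Iso.refl⟩

theorem iso_of_thin (S : CommonCard d G H σ v u t)
    (hcard : ∀ w, Nonempty (deleteVertex H w ≃g deleteVertex G (σ w))) {z : V} (htz : d t z = 1)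
    (hzu : z ≠ u) (htn : ∀ k, d k t = 1 → k = u ∨ k = z) : Nonempty (H ≃g G) := by
  classical
  have hd := S.tree
  have hc := hd.comm
  have hut := S.outer.adj_ut
  have htu := hc t u
  have hzt := hc z t
  have htu' : t ≠ u := hd.ne_of_pos (by omega)
  obtain ⟨hHt, hHz, hcl⟩ := S.clique_of_thin htz hzu htn
  have hstar : ∀ k, k ≠ u → d k u ≤ 2 → H.Adj u k := by
    intro k hku hk2
    by_cases hkc : d k u = 1 ∧ k ≠ t
    · exact S.adj_cls hkc.1 hkc.2
    have h1 := hd.outer_le_one S.outer hk2 hku hkc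
    by_cases hkt : k = t
    · rwa [hkt]
    have := hd.pos hkt
    rcases htn k (by omega) with h | h
    · exact absurd h hku
    · rwa [h]
  obtain ⟨w, p, s, hw, htw⟩ := S.exists_far_leaf
  obtain ⟨hwu, hwc, hwd⟩ := S.far_leaf_dist htw
  have hct := hc t w
  have htw' : w ≠ t := hd.ne_of_pos (by omega)
  -- By `clique_of_thin` a neighbour `w` of `u` would be adjacent to `t`, from which it is too far.
  have huw : ¬ H.Adj u w := by
    intro h
    have h1 := S.le_of_adj hwu htu' (hcl w t h hHt hwc (by simp) htw')
    omega
  have hGuw : ¬ G.Adj u w := by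
    rw [S.adj, hc]
    omega
  have hsw : openPairs H w = 0 := by
    rw [openPairs_eq_zero]
    intro a b ha hb hab
    have hau : a ≠ u := by
      rintro rfl
      exact huw ha.symm
    have hbu : b ≠ u := by
      rintro rfl
      exact huw hb.symm
    rw [S.agree _ _ hwu hau] at ha
    rw [S.agree _ _ hwu hbu] at hb
    rw [S.agree _ _ hau hbu]
    exact openPairs_eq_zero.1 (S.simplicial_far_leaf hw) a b ha hb hab
  obtain ⟨e, hH, _, hv, hu, ht, T, hcount⟩ := S.exists_twoTrees hstar hw htw hsw (hcard w)
  have hzw : z ≠ w := by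
    rintro rfl
    omega
  -- Here `g` is an inner vertex of the path from `z` to a vertex at distance at least 4, so it is
  -- not the leaf `w` and survives its deletion.
  obtain ⟨g, hgw, hgz, hgt⟩ : ∃ g, g ≠ w ∧ d g z = 3 ∧ d g t = 4 := by
    obtain ⟨f, hf⟩ := S.far z
    have hfz := hc f z
    have hfu : f ≠ u := by
      rintro rfl
      have := hd.triangle z t f
      omega
    have hft : f ≠ t := by
      rintro rfl
      omega
    have hfc : ¬ (d f u = 1 ∧ f ≠ t) := by
      rintro ⟨h1, h2⟩
      have := hd.triangle f u z
      have := hd.triangle u t z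
      omega
    have h1 := (hd.thin_dist S.outer htn hfu hfc hft).2
    obtain ⟨g, hg, hfg⟩ := hd.exists_on_path f z 3 (by omega)
    have := hc z g
    have h2 := hd.triangle f g t
    have h3 := hd.triangle g z t
    refine ⟨g, ?_, by omega, by omega⟩
    rintro rfl
    have hl := hw.leaf g hw.adj_vu hw.ne
    have h4 := hd.leaf_dist hl (k := f) (by rintro rfl; omega)
    have h5 := hd.leaf_dist hl (k := z) hzw
    have h6 := hd.triangle f p z
    have := hc p z
    omega
  have hHu : ∀ x, x ≠ w → (H.Adj u x ↔ x ≠ u ∧ e x u ≤ 3) := by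
    intro x hx
    rw [H.adj_comm, hH x u hx hu]
  have hGu : ∀ x, G.Adj u x ↔ x ≠ u ∧ d x u ≤ 3 := by
    intro x
    rw [G.adj_comm, S.adj]
  rcases T.agree_or_swap_of_thin (z := ⟨z, hzw⟩) (g := ⟨g, hgw⟩) htz (by simpa using hzu)
      (fun k hk => by
        rcases htn k.1 hk with h | h
        · exact Or.inl (Subtype.ext h)
        · exact Or.inr (Subtype.ext h))
      (hcount huw) hgz hgt with key | ⟨⟨y, hy⟩, ⟨y₁, hy₁⟩, hne, hyu, hy₁u, a1, a2, a3, a4, a5, a6⟩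
  · have : H = G := eq_of_adj_iff S.agree fun x => by
      by_cases hx : x = w
      · rw [hx]
        exact iff_of_false huw hGuw
      rw [hHu x hx, hGu, key ⟨x, hx⟩]
    rw [this]
    exact ⟨SimpleGraph.Iso.refl⟩
  · simp only [ne_eq, Subtype.mk.injEq, Subtype.forall] at hne hyu hy₁u a5 a6
    refine iso_of_moved_edge (w := w) S.agree hne hyu hy₁u hwu (Ne.symm hy) (Ne.symm hy₁)
      ((hGu y).2 ⟨hyu, a1⟩) (fun h => a2 ((hGu y₁).1 h).2) (fun h => a3 ((hHu y hy).1 h).2)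
      ((hHu y₁ hy₁).2 ⟨hy₁u, a4⟩) (fun x h1 h2 => ?_) (fun x hxu hxw h1 h2 => ?_) σ S.deg_eq
      (by rw [S.deg_eq, S.fixed])
    · by_cases hx : x = w
      · rw [hx]
        exact iff_of_false hGuw huw
      rw [hHu x hx, hGu, a5 x hx h1 h2]
    · rw [S.adj, S.adj, a6 x hxw hxu]
      simp [h1, h2]

theorem iso (S : CommonCard d G H σ v u t)
    (hcard : ∀ w, Nonempty (deleteVertex H w ≃g deleteVertex G (σ w))) : Nonempty (H ≃g G) := by
  have hd := S.tree
  have hc := hd.comm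
  obtain ⟨q, -, huq, htq⟩ := S.exists_far_tail
  obtain ⟨z, hz, hqz⟩ := hd.closer q t (hd.ne_of_pos (by omega))
  have hzu : z ≠ u := by
    rintro rfl
    have := hc q t
    have := hc q z
    omega
  by_cases hthin : ∀ k, d k t = 1 → k = u ∨ k = z
  · exact S.iso_of_thin hcard hz hzu hthin
  · push Not at hthin
    obtain ⟨k, hk, hku, hkz⟩ := hthin
    exact S.iso_of_thick hcard hkz (by rw [hc, hk]) hz hku hzu

end CommonCard

/-! ### Putting the cases together -/

/-- Equal degrees and equal orders make `w` dominating in `H`, so the isomorphism of cards extends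
by sending `w` to `x`. -/
theorem iso_of_dominating {V W : Type*} [Fintype V] [Fintype W] {G : SimpleGraph V}
    {H : SimpleGraph W} {x : V} {w : W} (hx : ∀ y, y ≠ x → G.Adj x y)
    (hdeg : deg H w = deg G x) (φ : deleteVertex H w ≃g deleteVertex G x) :
    Nonempty (H ≃g G) := by
  classical
  obtain ⟨τ, hτw, hτ⟩ := exists_equiv_of_card_iso φ
  have hG : deg G x + 1 = Fintype.card V := by
    rw [deg_add_one (p := fun _ => True) fun y => ?_]
    · simp
    · have := hx y
      tauto
  have hw : ∀ y, y ≠ w → H.Adj w y := by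
    have h1 := deg_add_one (G := H) (x := w) (p := fun y => y = w ∨ H.Adj w y) fun y => Iff.rfl
    rw [hdeg, hG, ← Fintype.card_congr τ, eq_comm, ← Finset.card_univ,
      Finset.card_filter_eq_iff] at h1
    intro y hy
    exact (h1 y (Finset.mem_univ y)).resolve_left hy
  refine ⟨⟨τ, fun {a b} => ?_⟩⟩
  by_cases ha : a = w
  · subst ha
    by_cases hb : b = a
    · subst hb
      simp
    · exact iff_of_true (hτw ▸ hx _ fun h => hb (τ.injective (h.trans hτw.symm))) (hw b hb)
  by_cases hb : b = w
  · subst hb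
    rw [G.adj_comm, H.adj_comm]
    exact iff_of_true (hτw ▸ hx _ fun h => ha (τ.injective (h.trans hτw.symm))) (hw a ha)
  exact (hτ a b ha hb).symm

theorem deleteVertex_iso {V W : Type*} {G : SimpleGraph V} {H : SimpleGraph W} (e : G ≃g H)
    (v : V) : Nonempty (deleteVertex G v ≃g deleteVertex H (e v)) :=
  ⟨⟨e.toEquiv.subtypeEquiv fun a => by simp, fun {a b} => e.map_adj_iff⟩⟩

/-- The cube of a tree is determined by its cards. -/
theorem iso_of_matching {V W : Type*} [Fintype V] [Fintype W] {d : V → V → ℕ} (hd : IsTreeDist d)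
    {G : SimpleGraph V} (hG : ∀ x y, G.Adj x y ↔ x ≠ y ∧ d x y ≤ 3) (hV : 3 ≤ Fintype.card V)
    {H : SimpleGraph W} (σ : W ≃ V)
    (hσ : ∀ w, Nonempty (deleteVertex H w ≃g deleteVertex G (σ w))) : Nonempty (H ≃g G) := by
  classical
  by_cases hfar : ∀ x, ∃ f, 4 ≤ d x f
  swap
  · push Not at hfar
    obtain ⟨x, hx⟩ := hfar
    have h1 := hσ (σ.symm x)
    have h2 := deg_eq_of_matching σ hσ hV (σ.symm x)
    rw [Equiv.apply_symm_apply] at h1 h2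
    exact iso_of_dominating (fun y hy => (hG x y).2 ⟨hy.symm, Nat.le_of_lt_succ (hx y)⟩) h2 h1.some
  have simp_iff : ∀ x, openPairs G x = 0 ↔ ∀ a b, d x a ≤ 3 → d x b ≤ 3 → d a b ≤ 3 := by
    intro x
    rw [openPairs_eq_zero]
    constructor
    · intro h a b ha hb
      by_cases hxa : x = a
      · rwa [← hxa]
      by_cases hxb : x = b
      · rwa [← hxb, hd.comm]
      by_cases hab : a = b
      · rw [hab, hd.self]
        omega
      exact ((hG a b).1 (h a b ((hG x a).2 ⟨hxa, ha⟩) ((hG x b).2 ⟨hxb, hb⟩) hab)).2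
    · intro h a b ha hb hab
      exact (hG a b).2 ⟨hab, h a b ((hG x a).1 ha).2 ((hG x b).1 hb).2⟩
  obtain ⟨x₀⟩ : Nonempty V := Fintype.card_pos_iff.1 (by omega)
  obtain ⟨f₀, hf₀⟩ := hfar x₀
  obtain ⟨v₁, u₁, t₁, h₁, -⟩ := hd.exists_outer_of_far x₀ (f := f₀) (by omega)
  obtain ⟨v, hv, hmin⟩ := Finset.exists_min_image (Finset.univ.filter fun x => openPairs G x = 0)
    (deg G) ⟨v₁, by
      simp only [Finset.mem_filter, Finset.mem_univ, true_and]
      exact (simp_iff v₁).2 fun a b => hd.outer_simplicial h₁⟩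
  simp only [Finset.mem_filter, Finset.mem_univ, true_and] at hv hmin
  obtain ⟨f, hf⟩ := hfar v
  obtain ⟨u, t, q, ho, hvq, huq, htq⟩ := hd.exists_outer_of_simplicial hf ((simp_iff v).1 hv)
  have hcard : 4 ≤ Fintype.card V := by
    have hne : ∀ {a b : V}, 0 < d a b → a ≠ b := fun h => hd.ne_of_pos h
    have e₁ := hne (a := v) (b := u) (by rw [ho.adj_vu]; omega)
    have e₂ := hne (a := u) (b := t) (by rw [ho.adj_ut]; omega)
    have e₃ := hne (a := v) (b := q) (by omega)
    have e₄ := hne (a := u) (b := q) (by omega)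
    have e₅ := hne (a := t) (b := q) (by omega)
    have := Finset.card_le_univ ({v, u, t, q} : Finset V)
    rwa [Finset.card_insert_of_notMem (by simp [e₁, e₃, ho.ne]),
      Finset.card_insert_of_notMem (by simp [e₂, e₄]),
      Finset.card_pair e₅] at this
  obtain ⟨τ, hτu, hτ⟩ := exists_equiv_of_card_iso (hσ (σ.symm u)).some
  rw [Equiv.apply_symm_apply] at hτu
  -- The copy of `H` on the vertex set of `G`, placed so that the matched cards at `u` coincide.
  let H' : SimpleGraph V := H.comap τ.symm
  let ι : H' ≃g H := SimpleGraph.Iso.comap τ.symm H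
  have hσ' : ∀ x, Nonempty (deleteVertex H' x ≃g deleteVertex G ((τ.symm.trans σ) x)) := fun x =>
    ⟨(deleteVertex_iso ι x).some.trans (hσ (τ.symm x)).some⟩
  have S : CommonCard d G H' (τ.symm.trans σ) v u t :=
    { tree := hd
      adj := hG
      outer := ho
      far := hfar
      agree := fun x y hx hy => by
        have key : ∀ x, x ≠ u → τ.symm x ≠ σ.symm u := fun x hx h => hx (by
          rw [← hτu, ← h, Equiv.apply_symm_apply])
        have := hτ (τ.symm x) (τ.symm y) (key x hx) (key y hy)
        rwa [Equiv.apply_symm_apply, Equiv.apply_symm_apply] at this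
      fixed := by
        rw [Equiv.trans_apply, ← Equiv.eq_symm_apply, Equiv.symm_apply_eq, hτu]
      deg_eq := deg_eq_of_matching _ hσ' hV
      openPairs_eq := openPairs_eq_of_matching _ hσ' hcard
      minimal := hmin }
  obtain ⟨ψ⟩ := S.iso hσ'
  exact ⟨ι.symm.trans ψ⟩

end TreeCube

theorem theorem4p1 {V W : Type*} [Fintype V] [Fintype W]
    (G : SimpleGraph V) (hG : TreeCube.IsCubeOfTree G) (hV : 3 ≤ Fintype.card V)
    (H : SimpleGraph W) (hdeck : TreeCube.deck H = TreeCube.deck G) :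
    Nonempty (H ≃g G) := by
  obtain ⟨U, T, hT, ⟨e⟩⟩ := hG
  obtain ⟨σ, hσ⟩ := TreeCube.exists_matching_of_deck_eq hdeck
  refine TreeCube.iso_of_matching (hT.isTreeDist.comp_equiv e.toEquiv) (fun x y => ?_) hV σ hσ
  rw [← e.map_adj_iff, TreeCube.power_adj hT, e.injective.ne_iff]
  rfl
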